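/- **Proposition.** Let $q>3$ be an odd prime power, $G=SL_2(\mathbb F_q)$, and let $\widehat G$ be the set of isomorphism classes of irreducible finite-dimensional complex representations (irreps) of $G$. For $k\ge 0$ let $F^k$ be the $\mathbb Z$-span, in the representation ring $R(G)=\mathbb Z[\widehat G]$, of the irreps that appear in some $\ell$-fold tensor product, $0\le \ell\le k$, of irreps of dimension $\frac{q+1}{2}$ or $\frac{q-1}{2}$ (the $0$-fold product being the trivial representation). A nonzero representation has tensor rank $k$ if it lies in $F^k$ but not in $F^j$ for any $j<k$; let $\widehat G_k$ be the set of irreps of tensor rank $k$, and for $g\in G$ put $$S_k(g)=\sum_{\rho\in\widehat G_k}\frac{\chi_\rho(g)}{\dim\rho}.$$ Let $\varepsilon\in\mathbb F_q$ be a non-square and let $g\in G$ with $g\neq\pm I$. Write $g\sim u$ if $g$ is conjugate in $G$ to $\begin{pmatrix}1&1\\0&1\end{pmatrix}$ or to $\begin{pmatrix}1&\varepsilon\\0&1\end{pmatrix}$. Then $$S_1(g)=\begin{cases}O(1/q^2)&\text{if } g\sim u,\\ O(1/q)&\text{otherwise,}\end{cases}\qquad\text{and}\qquad S_2(g)=O(1/q),$$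 where the implied constants are absolute (independent of $q$, $\varepsilon$ and $g$). More precisely, $$|S_1(g)|=\frac{4}{q^2-1}\ \text{ if } g\sim u,\qquad \left||S_1(g)|-\frac{4}{q+1}\right|\le\frac{8}{q^2-1}\ \text{ otherwise},\qquad |S_2(g)|\le\frac{2}{q+1}+\frac{5}{q^2-1}.$$ -/

import Mathlib

open CategoryTheory MonoidalCategory

noncomputable section

namespace TensorRank

/-- Finite-dimensional irreducible complex representations of `G` (up to isomorphism they exhaust
the irreps, since `FDRep ℂ G` contains all finite-dimensional complex representations). -/
abbrev SimpleRep (G : Type*) [Group G] : Type _ := {V : FDRep ℂ G // Simple V}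

/-- Isomorphism of irreducible representations. -/
instance isoSetoid (G : Type*) [Group G] : Setoid (SimpleRep G) where
  r V W := Nonempty (V.1 ≅ W.1)
  iseqv :=
    ⟨fun V => ⟨Iso.refl V.1⟩, fun ⟨e⟩ => ⟨e.symm⟩, fun ⟨e⟩ ⟨f⟩ => ⟨e ≪≫ f⟩⟩

/-- The unitary dual `Ĝ`: the set of isomorphism classes of irreducible representations. -/
abbrev Irrep (G : Type*) [Group G] : Type _ := Quotient (isoSetoid G)

/-- The character `χ_ρ` of an isomorphism class of irreducible representations. -/
def Irrep.character {G : Type*} [Group G] : Irrep G → G → ℂ :=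
  Quotient.lift (fun V => V.1.character) (fun _ _ ⟨e⟩ => FDRep.char_iso e)

/-- The dimension of an isomorphism class of irreducible representations. -/
def Irrep.dim {G : Type*} [Group G] : Irrep G → ℕ :=
  Quotient.lift (fun V => Module.finrank ℂ V.1)
    (fun _ _ ⟨e⟩ => (FDRep.isoToLinearEquiv e).finrank_eq)

/-- A finite group has only finitely many irreducible representations up to isomorphism. -/
instance Irrep.finite {G : Type*} [Group G] [Finite G] : Finite (Irrep G) := by
  classical
  have := Fintype.ofFinite G
  have : Invertible (Nat.card G : ℂ) :=
    invertibleOfNonzero (by exact_mod_cast Nat.card_pos.ne')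
  have orth : ∀ x y : Irrep G, (Nat.card G : ℂ)⁻¹ *
      ∑ g : G, x.character g * y.character g⁻¹ = if x = y then 1 else 0 := by
    intro x y
    induction x using Quotient.inductionOn with | _ V =>
    induction y using Quotient.inductionOn with | _ W =>
    have := V.2
    have := W.2
    have h := FDRep.char_orthonormal V.1 W.1
    have e : ((⟦V⟧ : Irrep G) = ⟦W⟧) ↔ Nonempty (V.1 ≅ W.1) := Quotient.eq
    simp only [e]
    exact h
  have li : LinearIndependent ℂ (fun x : Irrep G => x.character) := by
    rw [linearIndependent_iff']
    intro s c hc y hy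
    have h1 : (Nat.card G : ℂ)⁻¹ *
        ∑ g : G, (∑ x ∈ s, c x • x.character) g * y.character g⁻¹ = 0 := by
      rw [hc]; simp
    have h2 : (Nat.card G : ℂ)⁻¹ *
        ∑ g : G, (∑ x ∈ s, c x • x.character) g * y.character g⁻¹ =
        ∑ x ∈ s, c x * ((Nat.card G : ℂ)⁻¹ *
          ∑ g : G, x.character g * y.character g⁻¹) := by
      simp only [Finset.sum_apply, Pi.smul_apply, smul_eq_mul, Finset.sum_mul, Finset.mul_sum]
      rw [Finset.sum_comm]
      refine Finset.sum_congr rfl fun x _ => Finset.sum_congr rfl fun g _ => by ring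
    rw [h2] at h1
    simp only [orth] at h1
    simpa [hy] using h1
  exact li.finite

section SL2

variable (F : Type*) [Field F] [Fintype F]

/-- The group `SL₂(𝔽_q)`. -/
abbrev SL2 : Type _ := Matrix.SpecialLinearGroup (Fin 2) F

/-- The irreducible representations of `SL₂(𝔽_q)` of dimension `(q + 1) / 2` or `(q - 1) / 2`. -/
def IsGenerator (V : FDRep ℂ (SL2 F)) : Prop :=
  Simple V ∧
    (2 * Module.finrank ℂ V = Fintype.card F + 1 ∨ 2 * Module.finrank ℂ V + 1 = Fintype.card F)

variable {F}

/-- The tensor product of a list of representations; the empty product is the trivial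
representation. -/
def tensorList : List (FDRep ℂ (SL2 F)) → FDRep ℂ (SL2 F)
  | [] => 𝟙_ (FDRep ℂ (SL2 F))
  | V :: l => V ⊗ tensorList l

/-- `U` is isomorphic to a subrepresentation of `V`. -/
def AppearsIn (U V : FDRep ℂ (SL2 F)) : Prop := ∃ f : U ⟶ V, Mono f

/-- Membership of a representation in the `k`-th step `F^k` of the tensor rank filtration of the
representation ring: `F^k` is the `ℤ`-span of the irreps that appear in an `ℓ`-fold tensor product,
`ℓ ≤ k`, of irreps of dimension `(q ± 1) / 2`; so `V` is in `F^k` iff every irrep that appears in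
`V` appears in such a tensor product. -/
def MemFiltration (k : ℕ) (V : FDRep ℂ (SL2 F)) : Prop :=
  ∀ U : FDRep ℂ (SL2 F), Simple U → AppearsIn U V →
    ∃ l : List (FDRep ℂ (SL2 F)), l.length ≤ k ∧ (∀ W ∈ l, IsGenerator F W) ∧
      AppearsIn U (tensorList l)

/-- `V` has tensor rank `k`: it lies in `F^k` but in no earlier step of the filtration. -/
def HasTensorRank (k : ℕ) (V : FDRep ℂ (SL2 F)) : Prop :=
  MemFiltration k V ∧ ∀ j < k, ¬ MemFiltration j V

variable (F) in
/-- The set `Ĝ_k` of (isomorphism classes of) irreps of tensor rank `k`. -/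
def irrepsOfRank (k : ℕ) : Set (Irrep (SL2 F)) :=
  {x | ∃ V : SimpleRep (SL2 F), ⟦V⟧ = x ∧ HasTensorRank k V.1}

/-- The sum `S_k(g)` of the character ratios `χ_ρ(g) / dim ρ` over the irreps `ρ` of tensor
rank `k`. -/
def ratioSum (k : ℕ) (g : SL2 F) : ℂ :=
  ∑ x ∈ (Set.toFinite (irrepsOfRank F k)).toFinset, x.character g / (x.dim : ℂ)

/-- The unipotent matrix `(1 b; 0 1)`. -/
def unipotent (b : F) : SL2 F := ⟨!![1, b; 0, 1], by simp [Matrix.det_fin_two]⟩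

end SL2

end TensorRank

end

/-!
Only a small part of the character table of `SL₂(𝔽_q)` is needed. The Weil representations attached
to an additive character and to its twist by a non-square are explicit matrix representations on
functions on `𝔽_q`; each splits under `-1` into an even and an odd irreducible constituent. This
gives four irreps of dimension `(q ± 1) / 2`, with sums of characters known everywhere. They
account for the whole difference between the two classes of unipotent elements in the column
orthogonality relations, so every other nontrivial irrep is constant on `u ≠ 1` unipotent.
Counting conjugacy classes then shows that it has dimension `q - 1 + f`, with `f` the dimension of
its space of vectors fixed by the unipotent subgroup; and `f` is `0` or `2`, apart from one irrep
with `f = 1`, the Steinberg representation.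

Hence the four constituents are the only generators, and they make up the irreps of tensor rank one.
The square of the sum `ω` of their characters takes the value `4` outside the elements of trace two,
which gives `∑ ω² χ ≠ 0` for each of the other nontrivial irreps `χ`: these have tensor rank two.

Let `e = χ₀(tr g - 2)` and `e' = χ₀(tr g + 2)`, for the quadratic character `χ₀`. The sums of the
characters of the constituents of dimension `(q ± 1) / 2` are `e ± e'`, and the first sum of ratios
is `4 (q e - e') / (q² - 1)`. For the second one, `1 / dim` is affine in `f` up to a correction for
the Steinberg representation, whose character is `e e'`; so it suffices to know the sums of `χ(g)`
and of `f χ(g)`, and these follow from column orthogonality of `g` with `1` and with the unipotent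
elements.
-/

noncomputable section

namespace TensorRank

section Decomposition

variable {G : Type*} [Group G]

theorem simple_of_isIrreducible {V : Type} [AddCommGroup V] [Module ℂ V]
    [FiniteDimensional ℂ V] (ρ : Representation ℂ G V) [ρ.IsIrreducible] :
    Simple (FDRep.of ρ) := by
  let T := forget₂ (FDRep ℂ G) (Rep ℂ G)
  have : (T.obj (FDRep.of ρ)).ρ.IsIrreducible := ‹ρ.IsIrreducible›
  refine ⟨fun {Y} f _ => ⟨?_, fun hf => ?_⟩⟩
  · rintro hi rfl
    have hid : 𝟙 (FDRep.of ρ) = 0 := by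
      rw [← IsIso.inv_hom_id (0 : Y ⟶ FDRep.of ρ), Limits.comp_zero]
    have hV (v : V) : v = 0 :=
      congrArg (fun f : FDRep.of ρ ⟶ FDRep.of ρ => (T.map f).hom.toLinearMap v) hid
    refine bot_ne_top (α := Subrepresentation ρ) (SetLike.ext fun v =>
      ⟨fun _ => trivial, fun _ => ?_⟩)
    rw [hV v]
    exact Submodule.zero_mem (⊥ : Submodule ℂ V)
  · have hsurj := (Representation.IsIrreducible.surjective_or_eq_zero (T.map f).hom).resolve_right
      fun h => hf (T.map_injective (Rep.hom_ext h))
    have : Epi (T.map f) := (Rep.epi_iff_surjective _).2 hsurj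
    have : IsIso (T.map f) := isIso_of_mono_of_epi _
    exact isIso_of_reflects_iso f T

theorem trace_eq_add_of_isCompl {V : Type*} [AddCommGroup V] [Module ℂ V]
    [FiniteDimensional ℂ V] {ρ : Representation ℂ G V} {W W' : Subrepresentation ρ}
    (h : IsCompl W.toSubmodule W'.toSubmodule) (g : G) :
    LinearMap.trace ℂ V (ρ g) = LinearMap.trace ℂ W.toSubmodule (W.toRepresentation g) +
      LinearMap.trace ℂ W'.toSubmodule (W'.toRepresentation g) := by
  have hint : DirectSum.IsInternal (fun b : Bool => cond b W.toSubmodule W'.toSubmodule) :=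
    (DirectSum.isInternal_submodule_iff_isCompl _ (i := true) (j := false) (by decide)
      (by ext b; cases b <;> simp)).2 h
  have hmaps (b : Bool) : Set.MapsTo (ρ g)
      ((cond b W.toSubmodule W'.toSubmodule : Submodule ℂ V) : Set V)
      ((cond b W.toSubmodule W'.toSubmodule : Submodule ℂ V) : Set V) := by
    cases b
    · exact fun v hv => W'.apply_mem_toSubmodule g hv
    · exact fun v hv => W.apply_mem_toSubmodule g hv
  rw [LinearMap.trace_eq_sum_trace_restrict hint hmaps, Fintype.sum_bool]
  rfl

theorem exists_isCompl_of_not_isIrreducible [Finite G] {V : Type*} [AddCommGroup V] [Module ℂ V]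
    [Nontrivial V] {ρ : Representation ℂ G V} (hρ : ¬ ρ.IsIrreducible) :
    ∃ W W' : Subrepresentation ρ, IsCompl W.toSubmodule W'.toSubmodule ∧
      W.toSubmodule ≠ ⊤ ∧ W'.toSubmodule ≠ ⊤ := by
  have : Nontrivial (Subrepresentation ρ) :=
    ⟨⊥, ⊤, fun h => bot_ne_top (α := Submodule ℂ V)
      (congrArg Subrepresentation.toSubmodule h)⟩
  obtain ⟨W, hbot, htop⟩ : ∃ W : Subrepresentation ρ, W ≠ ⊥ ∧ W ≠ ⊤ := by
    by_contra! h
    exact hρ ⟨fun W => or_iff_not_imp_left.2 (h W)⟩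
  have : NeZero (Nat.card G : ℂ) := ⟨by exact_mod_cast Nat.card_pos.ne'⟩
  obtain ⟨W', hc⟩ := exists_isCompl W
  have hc' : IsCompl W.toSubmodule W'.toSubmodule :=
    IsCompl.of_eq (congrArg Subrepresentation.toSubmodule hc.inf_eq_bot)
      (congrArg Subrepresentation.toSubmodule hc.sup_eq_top)
  refine ⟨W, W', hc', fun h => htop (Subrepresentation.toSubmodule_injective h), fun h => ?_⟩
  rw [h] at hc'
  exact hbot (Subrepresentation.toSubmodule_injective (eq_bot_of_isCompl_top hc'))

variable [Finite G]

instance Irrep.instFintype : Fintype (Irrep G) := Fintype.ofFinite _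

theorem exists_trace_eq_sum_character (V : Type) [AddCommGroup V] [Module ℂ V]
    [FiniteDimensional ℂ V] (ρ : Representation ℂ G V) :
    ∃ m : Irrep G → ℕ, ∀ g, LinearMap.trace ℂ V (ρ g) = ∑ x, (m x : ℂ) * x.character g := by
  classical
  induction hn : Module.finrank ℂ V using Nat.strong_induction_on generalizing V with
  | _ n ih =>
  by_cases hirr : ρ.IsIrreducible
  · refine ⟨Pi.single ⟦⟨FDRep.of ρ, simple_of_isIrreducible ρ⟩⟧ 1, fun g => ?_⟩
    rw [Finset.sum_eq_single ⟦⟨FDRep.of ρ, simple_of_isIrreducible ρ⟩⟧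
      (fun x _ hx => by rw [Pi.single_eq_of_ne hx, Nat.cast_zero, zero_mul]) (by simp),
      Pi.single_eq_same, Nat.cast_one, one_mul]
    rfl
  rcases subsingleton_or_nontrivial V with hV | hV
  · exact ⟨0, fun g => by simp [Subsingleton.elim (ρ g) 0]⟩
  obtain ⟨W, W', hc, hW, hW'⟩ := exists_isCompl_of_not_isIrreducible hirr
  obtain ⟨m, hm⟩ := ih _ (hn ▸ Submodule.finrank_lt hW) W.toSubmodule W.toRepresentation rfl
  obtain ⟨m', hm'⟩ := ih _ (hn ▸ Submodule.finrank_lt hW') W'.toSubmodule W'.toRepresentation rfl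
  refine ⟨m + m', fun g => ?_⟩
  simp only [trace_eq_add_of_isCompl hc, hm, hm', Pi.add_apply, Nat.cast_add, add_mul,
    Finset.sum_add_distrib]

theorem exists_character_eq_sum (V : FDRep ℂ G) :
    ∃ m : Irrep G → ℕ, ∀ g, V.character g = ∑ x, (m x : ℂ) * x.character g :=
  exists_trace_eq_sum_character V V.ρ

end Decomposition

section Character

variable {G : Type*} [Group G]

theorem Irrep.character_eq_of_isConj (x : Irrep G) {g h : G} (hc : IsConj g h) :
    x.character g = x.character h := by
  induction x using Quotient.inductionOn with | _ V =>
  obtain ⟨c, rfl⟩ := isConj_iff.1 hc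
  exact (FDRep.char_conj V.1 g c).symm

theorem Irrep.character_one (x : Irrep G) : x.character 1 = x.dim := by
  induction x using Quotient.inductionOn with | _ V =>
  exact FDRep.char_one V.1

theorem Irrep.dim_pos (x : Irrep G) : 0 < x.dim := by
  induction x using Quotient.inductionOn with | _ V =>
  refine Nat.pos_of_ne_zero fun h => ?_
  have := Module.finrank_zero_iff.1 h
  have := V.2
  refine Simple.not_isZero V.1 ((Limits.IsZero.iff_id_eq_zero _).2 ?_)
  ext v
  exact Subsingleton.elim (α := V.1) _ _

theorem exists_fdRep_of_matrix {n : Type*} [Fintype n] [DecidableEq n] (M : G →* Matrix n n ℂ) :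
    ∃ V : FDRep ℂ G, ∀ g, V.character g = (M g).trace := by
  let e := Fintype.equivFin n
  let ρ : Representation ℂ G (Fin (Fintype.card n) → ℂ) :=
    (Matrix.toLinAlgEquiv' : _ ≃ₐ[ℂ] _).toAlgHom.toMonoidHom.comp
      ((Matrix.reindexAlgEquiv ℂ ℂ e).toAlgHom.toMonoidHom.comp M)
  refine ⟨FDRep.of ρ, fun g => ?_⟩
  change LinearMap.trace ℂ _ (Matrix.toLin' (Matrix.reindex e e (M g))) = _
  rw [Matrix.trace_toLin'_eq]
  exact (Fintype.sum_equiv e _ _ fun i => by simp [Matrix.diag]).symm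

theorem exists_smul_of_commute (V : FDRep ℂ G) [Simple V] (A : V →ₗ[ℂ] V)
    (hA : ∀ g, A ∘ₗ V.ρ g = V.ρ g ∘ₗ A) : ∃ c : ℂ, A = c • LinearMap.id := by
  let f : V ⟶ V := ⟨FGModuleCat.ofHom A, fun g => by
    ext v
    exact congrArg (fun l : V →ₗ[ℂ] V => l v) (hA g)⟩
  obtain ⟨c, hc⟩ := endomorphism_simple_eq_smul_id ℂ f
  exact ⟨c, (congrArg (fun f : V ⟶ V => f.hom.hom.hom) hc).symm⟩

theorem simple_unit : Simple (𝟙_ (FDRep ℂ G)) := by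
  have : (1 : Representation ℂ G ℂ).IsIrreducible :=
    { exists_pair_ne := ⟨⊥, ⊤, fun h => bot_ne_top (α := Submodule ℂ ℂ)
        (congrArg Subrepresentation.toSubmodule h)⟩
      eq_bot_or_eq_top := fun W => (eq_bot_or_eq_top W.toSubmodule).imp
        (fun h => Subrepresentation.toSubmodule_injective h)
        (fun h => Subrepresentation.toSubmodule_injective h) }
  have e : 𝟙_ (FDRep ℂ G) ≅ FDRep.of (1 : Representation ℂ G ℂ) :=
    Action.mkIso (Iso.refl _) (fun g => rfl)
  have := simple_of_isIrreducible (1 : Representation ℂ G ℂ)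
  exact Simple.of_iso e

/-- The class of the trivial representation. -/
def Irrep.triv (G : Type*) [Group G] : Irrep G := ⟦⟨𝟙_ (FDRep ℂ G), simple_unit⟩⟧

theorem Irrep.character_triv (g : G) : (Irrep.triv G).character g = 1 := by
  change LinearMap.trace ℂ ℂ LinearMap.id = 1
  rw [LinearMap.trace_id, Module.finrank_self, Nat.cast_one]

theorem Irrep.dim_triv : (Irrep.triv G).dim = 1 := by
  exact_mod_cast (Irrep.triv G).character_one.symm.trans (Irrep.character_triv 1)

end Character

section Conjugate

open Matrix

variable {G : Type*} [Group G]

-- Averaging produces a positive definite form, with respect to which every `M g` is unitary.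
theorem exists_isUnit_conjTranspose_mul_mul [Finite G] {n : Type*} [Fintype n] [DecidableEq n]
    (M : G →* Matrix n n ℂ) : ∃ H : Matrix n n ℂ, IsUnit H ∧ ∀ g, (M g)ᴴ * H * M g = H := by
  classical
  have := Fintype.ofFinite G
  refine ⟨∑ k, (M k)ᴴ * M k, ?_, fun g => ?_⟩
  · open scoped ComplexOrder in
    rw [← Finset.add_sum_erase _ _ (Finset.mem_univ 1), map_one, conjTranspose_one, one_mul]
    exact (PosDef.one.add_posSemidef
      (posSemidef_sum _ fun k _ => posSemidef_conjTranspose_mul_self _)).isUnit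
  · simp only [Finset.mul_sum, Finset.sum_mul]
    exact Fintype.sum_equiv (Equiv.mulRight g) _ _ fun k => by simp [mul_assoc]

theorem trace_matrix_inv [Finite G] {n : Type*} [Fintype n] [DecidableEq n]
    (M : G →* Matrix n n ℂ) (g : G) : (M g⁻¹).trace = star (M g).trace := by
  obtain ⟨_, ⟨u, rfl⟩, hu⟩ := exists_isUnit_conjTranspose_mul_mul M
  have hg : M g * M g⁻¹ = 1 := by rw [← map_mul, mul_inv_cancel, map_one]
  have h : M g⁻¹ = (↑u⁻¹ : Matrix n n ℂ) * ((M g)ᴴ * u) := by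
    rw [Units.eq_inv_mul_iff_mul_eq, ← mul_one ((M g)ᴴ * _), ← hg, ← mul_assoc, hu]
  rw [h, trace_mul_comm, mul_assoc, Units.mul_inv, mul_one, trace_conjTranspose]

theorem character_inv [Finite G] (V : FDRep ℂ G) (g : G) :
    V.character g⁻¹ = star (V.character g) := by
  let b := Module.finBasis ℂ V
  let M : G →* Matrix _ _ ℂ := (LinearMap.toMatrixAlgEquiv b).toAlgHom.toMonoidHom.comp V.ρ
  have h (g : G) : V.character g = (M g).trace := LinearMap.trace_eq_matrix_trace ℂ b (V.ρ g)
  rw [h, h, trace_matrix_inv]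

theorem Irrep.character_inv [Finite G] (x : Irrep G) (g : G) :
    x.character g⁻¹ = star (x.character g) := by
  induction x using Quotient.inductionOn with | _ V =>
  exact TensorRank.character_inv V.1 g

end Conjugate

section Orthogonality

variable {G : Type*} [Group G]

section Fintype

variable [Fintype G]

theorem card_cast_ne_zero {α : Type*} [Fintype α] [Nonempty α] : (Fintype.card α : ℂ) ≠ 0 :=
  Nat.cast_ne_zero.2 Fintype.card_ne_zero

open scoped Classical in
theorem Irrep.sum_character_mul_star (x y : Irrep G) :
    ∑ g, x.character g * star (y.character g) = if x = y then (Fintype.card G : ℂ) else 0 := by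
  have hG : (Nat.card G : ℂ) ≠ 0 := by exact_mod_cast Nat.card_pos.ne'
  have := invertibleOfNonzero hG
  simp only [← Irrep.character_inv]
  induction x using Quotient.inductionOn with | _ V =>
  induction y using Quotient.inductionOn with | _ W =>
  have := V.2
  have := W.2
  have hiso : ((⟦V⟧ : Irrep G) = ⟦W⟧) ↔ Nonempty (V.1 ≅ W.1) := Quotient.eq
  have h := FDRep.char_orthonormal V.1 W.1
  rw [inv_mul_eq_iff_eq_mul₀ hG, mul_ite, mul_one, mul_zero, Nat.card_eq_fintype_card] at h
  simp only [hiso]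
  exact h

theorem sum_character_mul_star_eq_finrank (V W : FDRep ℂ G) :
    ∑ g, W.character g * star (V.character g) =
      Fintype.card G * (Module.finrank ℂ (V ⟶ W) : ℂ) := by
  have hG : (Nat.card G : ℂ) ≠ 0 := by exact_mod_cast Nat.card_pos.ne'
  have := invertibleOfNonzero hG
  have h := FDRep.scalar_product_char_eq_finrank_equivariant V W
  rw [inv_mul_eq_iff_eq_mul₀ hG, Nat.card_eq_fintype_card] at h
  simp only [← TensorRank.character_inv, h]

theorem sum_mul_star_character_of_eq_sum {φ : G → ℂ} {c : Irrep G → ℂ}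
    (h : ∀ g, φ g = ∑ x, c x * x.character g) (x : Irrep G) :
    ∑ g, φ g * star (x.character g) = Fintype.card G * c x := by
  classical
  simp only [h, Finset.sum_mul, mul_assoc]
  rw [Finset.sum_comm]
  simp only [← Finset.mul_sum, Irrep.sum_character_mul_star, mul_ite, mul_zero,
    Finset.sum_ite_eq', Finset.mem_univ, if_true]
  exact mul_comm _ _

theorem sum_mul_star_self_of_eq_sum {φ : G → ℂ} {c : Irrep G → ℂ}
    (h : ∀ g, φ g = ∑ x, c x * x.character g) :
    ∑ g, φ g * star (φ g) = Fintype.card G * ∑ x, c x * star (c x) := by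
  calc ∑ g, φ g * star (φ g)
      = ∑ g, ∑ x, star (c x) * (φ g * star (x.character g)) := by
        refine Finset.sum_congr rfl fun g _ => ?_
        conv_lhs => rw [h g, star_sum, ← h g, Finset.mul_sum]
        exact Finset.sum_congr rfl fun x _ => by rw [star_mul']; ring
    _ = ∑ x, star (c x) * (Fintype.card G * c x) := by
        rw [Finset.sum_comm]
        simp only [← Finset.mul_sum, sum_mul_star_character_of_eq_sum h]
    _ = Fintype.card G * ∑ x, c x * star (c x) := by
        rw [Finset.mul_sum]
        exact Finset.sum_congr rfl fun x _ => by ring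

open scoped Classical in
theorem sum_dim_mul_character (g : G) :
    ∑ x : Irrep G, (x.dim : ℂ) * x.character g = if g = 1 then (Fintype.card G : ℂ) else 0 := by
  let regular : G →* Matrix G G ℂ :=
    { toFun g := Matrix.of fun a b => if a = g * b then 1 else 0
      map_one' := by ext a b; simp [Matrix.one_apply]
      map_mul' g h := by ext a b; simp [Matrix.mul_apply, mul_assoc] }
  obtain ⟨V, hV⟩ := exists_fdRep_of_matrix regular
  have hV (g : G) : V.character g = if g = 1 then (Fintype.card G : ℂ) else 0 := by
    rw [hV]
    by_cases h : g = 1 <;> simp [regular, Matrix.trace, h]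
  obtain ⟨m, hm⟩ := exists_character_eq_sum V
  have hmd (x : Irrep G) : (m x : ℂ) = x.dim := by
    refine mul_left_cancel₀ (card_cast_ne_zero (α := G)) ?_
    rw [← sum_mul_star_character_of_eq_sum hm x]
    simp [hV, x.character_one]
  rw [← hV, hm]
  simp only [hmd]

-- By Schur's lemma `∑ k, ρ (k * g * k⁻¹)` is a scalar.
theorem Irrep.dim_mul_sum_character_conj_mul (x : Irrep G) (g h : G) :
    (x.dim : ℂ) * ∑ k, x.character (k * g * k⁻¹ * h) =
      Fintype.card G * (x.character g * x.character h) := by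
  induction x using Quotient.inductionOn with | _ V =>
  have := V.2
  let A : V.1 →ₗ[ℂ] V.1 := ∑ k, V.1.ρ (k * g * k⁻¹)
  obtain ⟨c, hc⟩ := exists_smul_of_commute V.1 A fun a => by
    change A * V.1.ρ a = V.1.ρ a * A
    simp only [A, Finset.sum_mul, Finset.mul_sum, ← map_mul]
    exact Fintype.sum_equiv (Equiv.mulLeft a⁻¹) _ _ fun k => by simp [mul_assoc]
  have htr : c * (Module.finrank ℂ V.1 : ℂ) = Fintype.card G * V.1.character g := by
    calc c * (Module.finrank ℂ V.1 : ℂ) = LinearMap.trace ℂ V.1 A := by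
          rw [hc, map_smul, LinearMap.trace_id, smul_eq_mul]
      _ = ∑ k, V.1.character (k * g * k⁻¹) := map_sum _ _ _
      _ = Fintype.card G * V.1.character g := by
          simp only [FDRep.char_conj, Finset.sum_const, Finset.card_univ, nsmul_eq_mul]
  have hsum : ∑ k, V.1.character (k * g * k⁻¹ * h) = c * V.1.character h := by
    calc ∑ k, V.1.character (k * g * k⁻¹ * h) = LinearMap.trace ℂ V.1 (A * V.1.ρ h) := by
          simp only [A, Finset.sum_mul, map_sum, ← map_mul, FDRep.character]
      _ = c * V.1.character h := by
          rw [hc, smul_mul_assoc, map_smul, smul_eq_mul]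
          rfl
  change (Module.finrank ℂ V.1 : ℂ) * ∑ k, V.1.character (k * g * k⁻¹ * h) =
    Fintype.card G * (V.1.character g * V.1.character h)
  rw [hsum, ← mul_assoc, mul_comm _ c, htr, mul_assoc]

open scoped Classical in
theorem sum_irrep_character_mul_star (g h : G) :
    ∑ x : Irrep G, x.character g * star (x.character h) =
      (Finset.univ.filter fun k : G => k * g * k⁻¹ = h).card := by
  refine mul_left_cancel₀ (card_cast_ne_zero (α := G)) ?_
  rw [Finset.mul_sum]
  simp only [← Irrep.character_inv, ← Irrep.dim_mul_sum_character_conj_mul, Finset.mul_sum]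
  rw [Finset.sum_comm]
  simp only [sum_dim_mul_character, mul_inv_eq_one]
  rw [← Finset.sum_filter, Finset.sum_const, nsmul_eq_mul, mul_comm]

theorem sum_dim_sq : ∑ x : Irrep G, (x.dim : ℂ) * x.dim = Fintype.card G := by
  classical
  have h := sum_dim_mul_character (1 : G)
  simpa only [Irrep.character_one, if_true] using h

end Fintype

variable [Finite G]

theorem Irrep.character_injective : Function.Injective (Irrep.character : Irrep G → G → ℂ) := by
  classical
  have := Fintype.ofFinite G
  intro x y h
  by_contra hne
  have hxy := x.sum_character_mul_star y
  rw [← h, x.sum_character_mul_star, if_pos rfl, if_neg hne] at hxy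
  exact card_cast_ne_zero (α := G) hxy

theorem sum_irrep_character_mul_star_of_not_isConj {g h : G} (hn : ¬ IsConj g h) :
    ∑ x : Irrep G, x.character g * star (x.character h) = 0 := by
  classical
  have := Fintype.ofFinite G
  rw [sum_irrep_character_mul_star, Finset.filter_false_of_mem fun k _ hk =>
    hn (isConj_iff.2 ⟨k, hk⟩), Finset.card_empty, Nat.cast_zero]

theorem card_le_card_irrep {ι : Type*} [Fintype ι] (f : ι → G)
    (hf : ∀ i j, IsConj (f i) (f j) → i = j) : Fintype.card ι ≤ Fintype.card (Irrep G) := by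
  classical
  have := Fintype.ofFinite G
  have hli : LinearIndependent ℂ (fun i : ι => fun x : Irrep G => x.character (f i)) := by
    rw [Fintype.linearIndependent_iff]
    intro c hc j
    have hsum : ∑ i, c i * ∑ x : Irrep G, x.character (f i) * star (x.character (f j)) = 0 := by
      simp only [Finset.mul_sum]
      rw [Finset.sum_comm]
      refine Finset.sum_eq_zero fun x _ => ?_
      have h := congrFun hc x
      simp only [Finset.sum_apply, Pi.smul_apply, smul_eq_mul, Pi.zero_apply] at h
      simp only [← mul_assoc, ← Finset.sum_mul, h, zero_mul]
    rw [Finset.sum_eq_single_of_mem j (Finset.mem_univ j) fun i _ hij => by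
      rw [sum_irrep_character_mul_star_of_not_isConj fun h => hij (hf i j h), mul_zero],
      sum_irrep_character_mul_star] at hsum
    refine (mul_eq_zero.1 hsum).resolve_right (Nat.cast_ne_zero.2 ?_)
    exact (Finset.card_pos.2 ⟨1, by simp⟩).ne'
  simpa using hli.fintype_card_le_finrank

end Orthogonality

theorem isConj_of_mul_eq {G : Type*} [Group G] {g h k : G} (e : g * k = k * h) : IsConj g h :=
  isConj_iff.2 ⟨k⁻¹, by rw [inv_inv, mul_assoc, e, inv_mul_cancel_left]⟩

theorem ne_zero_of_not_isSquare {F : Type*} [Field F] {ε : F} (hε : ¬ IsSquare ε) : ε ≠ 0 :=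
  fun h => hε (h ▸ IsSquare.zero)

section Group

variable {F : Type*} [Field F]

/-- The matrix `(a b; c d)` of determinant one. -/
def SL2.mk (a b c d : F) (h : a * d - b * c = 1) : SL2 F :=
  ⟨!![a, b; c, d], by rw [Matrix.det_fin_two_of, h]⟩

/-- The upper triangular matrix `(a b; 0 a⁻¹)`. -/
def upper (a : Fˣ) (b : F) : SL2 F := SL2.mk a b 0 (a⁻¹ : Fˣ) (by simp)

section Entries

variable (a b c d : F) (h : a * d - b * c = 1) (u : Fˣ)

@[simp] theorem SL2.mk_apply_zero_zero : (SL2.mk a b c d h).1 0 0 = a := rfl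
@[simp] theorem SL2.mk_apply_zero_one : (SL2.mk a b c d h).1 0 1 = b := rfl
@[simp] theorem SL2.mk_apply_one_zero : (SL2.mk a b c d h).1 1 0 = c := rfl
@[simp] theorem SL2.mk_apply_one_one : (SL2.mk a b c d h).1 1 1 = d := rfl

@[simp] theorem unipotent_apply_zero_zero : (unipotent b).1 0 0 = 1 := rfl
@[simp] theorem unipotent_apply_zero_one : (unipotent b).1 0 1 = b := rfl
@[simp] theorem unipotent_apply_one_zero : (unipotent b).1 1 0 = 0 := rfl
@[simp] theorem unipotent_apply_one_one : (unipotent b).1 1 1 = 1 := rfl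

@[simp] theorem upper_apply_zero_zero : (upper u b).1 0 0 = u := rfl
@[simp] theorem upper_apply_zero_one : (upper u b).1 0 1 = b := rfl
@[simp] theorem upper_apply_one_zero : (upper u b).1 1 0 = 0 := rfl
@[simp] theorem upper_apply_one_one : (upper u b).1 1 1 = (u⁻¹ : Fˣ) := rfl

end Entries

theorem SL2.ext_iff_entries {g h : SL2 F} : g = h ↔ g.1 0 0 = h.1 0 0 ∧ g.1 0 1 = h.1 0 1 ∧
    g.1 1 0 = h.1 1 0 ∧ g.1 1 1 = h.1 1 1 := by
  refine ⟨fun e => by simp [e], fun ⟨h00, h01, h10, h11⟩ => ?_⟩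
  ext i j
  fin_cases i <;> fin_cases j <;> assumption

theorem SL2.det_eq (g : SL2 F) : g.1 0 0 * g.1 1 1 - g.1 0 1 * g.1 1 0 = 1 := by
  rw [← Matrix.det_fin_two, g.2]

theorem SL2.mul_apply (g h : SL2 F) (i j : Fin 2) :
    (g * h).1 i j = g.1 i 0 * h.1 0 j + g.1 i 1 * h.1 1 j := by
  rw [Matrix.SpecialLinearGroup.coe_mul, Matrix.mul_apply, Fin.sum_univ_two]

theorem upper_mul (a a' : Fˣ) (b b' : F) :
    upper a b * upper a' b' = upper (a * a') (a * b' + b * (a'⁻¹ : Fˣ)) := by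
  simp [SL2.ext_iff_entries, SL2.mul_apply, mul_comm]

theorem upper_one_zero : upper (1 : Fˣ) (0 : F) = 1 := by
  simp [SL2.ext_iff_entries]

theorem upper_one_eq_unipotent (b : F) : upper 1 b = unipotent b := by
  simp [SL2.ext_iff_entries]

theorem unipotent_mul (b c : F) : unipotent b * unipotent c = unipotent (b + c) := by
  simp [← upper_one_eq_unipotent, upper_mul, add_comm]

theorem unipotent_zero : unipotent (0 : F) = 1 := by
  rw [← upper_one_eq_unipotent, upper_one_zero]

theorem unipotent_ne_one {b : F} (hb : b ≠ 0) : unipotent b ≠ 1 := fun h =>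
  hb (by simpa using congrArg (fun g : SL2 F => g.1 0 1) h)

theorem upper_inv (a : Fˣ) : (upper a (0 : F))⁻¹ = upper a⁻¹ 0 := by
  rw [inv_eq_iff_mul_eq_one, upper_mul]
  simp [upper_one_zero]

theorem trace_eq_of_isConj {g h : SL2 F} (hc : IsConj g h) : g.1.trace = h.1.trace := by
  obtain ⟨c, rfl⟩ := isConj_iff.1 hc
  rw [Matrix.SpecialLinearGroup.coe_mul, Matrix.trace_mul_comm,
    ← Matrix.SpecialLinearGroup.coe_mul, inv_mul_cancel_left]

theorem trace_neg (g : SL2 F) : (-g).1.trace = -g.1.trace := by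
  rw [Matrix.SpecialLinearGroup.coe_neg, Matrix.trace_neg]

theorem trace_one : (1 : SL2 F).1.trace = 2 := by simp

theorem trace_unipotent (b : F) : (unipotent b).1.trace = 2 := by
  rw [Matrix.trace_fin_two, unipotent_apply_zero_zero, unipotent_apply_one_one, one_add_one_eq_two]

theorem trace_upper (a : Fˣ) (b : F) : (upper a b).1.trace = a + (a⁻¹ : Fˣ) :=
  Matrix.trace_fin_two _

theorem trace_upper_eq_two_iff {a : Fˣ} {b : F} : (upper a b).1.trace = 2 ↔ a = 1 := by
  rw [trace_upper, Units.ext_iff]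
  refine ⟨fun h => ?_, fun h => by simp [h, one_add_one_eq_two]⟩
  have hsq : ((a : F) - 1) ^ 2 = 0 := by linear_combination (a : F) * h - a.mul_inv
  simpa [sub_eq_zero] using hsq

theorem isConj_neg_iff {g h : SL2 F} : IsConj (-g) (-h) ↔ IsConj g h := by
  simp only [isConj_iff, mul_neg, neg_mul, neg_inj]

theorem isConj_unipotent_mul_sq (s : Fˣ) (b : F) :
    IsConj (unipotent b) (unipotent ((s : F) ^ 2 * b)) := by
  refine isConj_iff.2 ⟨upper s 0, ?_⟩
  rw [upper_inv, ← upper_one_eq_unipotent, ← upper_one_eq_unipotent, upper_mul, upper_mul,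
    SL2.ext_iff_entries]
  simp [sq, mul_right_comm]

theorem isConj_upper_diag {a : Fˣ} (ha : a ≠ a⁻¹) (b : F) : IsConj (upper a b) (upper a 0) := by
  have hne : (a : F) - (a⁻¹ : Fˣ) ≠ 0 := fun h => ha (Units.ext (sub_eq_zero.1 h))
  refine isConj_iff.2 ⟨upper 1 (b / (a - (a⁻¹ : Fˣ))), ?_⟩
  rw [mul_inv_eq_iff_eq_mul, upper_mul, upper_mul, one_mul, mul_one]
  congr 1
  field_simp
  simp

theorem isConj_upper_diag_inv (a : Fˣ) : IsConj (upper a (0 : F)) (upper a⁻¹ 0) := by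
  refine isConj_of_mul_eq (k := SL2.mk 0 1 (-1) 0 (by simp)) ?_
  simp [SL2.ext_iff_entries, SL2.mul_apply]

theorem exists_isConj_upper {g : SL2 F} (h : ∃ a : Fˣ, g.1.trace = a + (a⁻¹ : Fˣ)) :
    ∃ (a : Fˣ) (b : F), IsConj g (upper a b) := by
  obtain ⟨a, h⟩ := h
  have hd := g.det_eq
  rw [Matrix.trace_fin_two] at h
  by_cases hc : g.1 1 0 = 0
  · rw [hc, mul_zero, sub_zero] at hd
    have hg : g = upper (Units.mkOfMulEqOne _ _ hd) (g.1 0 1) := by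
      simpa [SL2.ext_iff_entries, hc] using (inv_eq_of_mul_eq_one_right hd).symm
    exact ⟨_, _, by rw [← hg]⟩
  · have ha : (a : F) * (a⁻¹ : Fˣ) = 1 := by simp
    refine ⟨a, -(g.1 1 0)⁻¹, isConj_of_mul_eq
      (k := SL2.mk (a - g.1 1 1) (-(g.1 1 0)⁻¹) (g.1 1 0) 0 (by simp [hc])) ?_⟩
    simp only [SL2.ext_iff_entries, SL2.mul_apply, upper_apply_zero_zero, upper_apply_zero_one,
      upper_apply_one_zero, upper_apply_one_one, SL2.mk_apply_zero_zero, SL2.mk_apply_zero_one,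
      SL2.mk_apply_one_zero, SL2.mk_apply_one_one]
    generalize ((a⁻¹ : Fˣ) : F) = a' at *
    refine ⟨?_, ?_, ?_, ?_⟩
    · linear_combination a * h - hd + ha
    · field_simp
      linear_combination -h
    · ring
    · field_simp
      ring

theorem exists_isConj_unipotent {g : SL2 F} (h : g.1.trace = 2) (hg : g ≠ 1) :
    ∃ b : F, b ≠ 0 ∧ IsConj g (unipotent b) := by
  obtain ⟨a, b, hc⟩ := exists_isConj_upper (g := g) ⟨1, by rw [h]; norm_num⟩
  have ha : a = 1 := trace_upper_eq_two_iff.1 ((trace_eq_of_isConj hc).symm.trans h)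
  rw [ha, upper_one_eq_unipotent] at hc
  refine ⟨b, fun hb => hg ?_, hc⟩
  rwa [hb, unipotent_zero, isConj_one_left] at hc

theorem eq_unipotent_mul_mul_unipotent {g : SL2 F} (hc : g.1 1 0 ≠ 0) :
    g = unipotent ((g.1 0 0 - 1) / g.1 1 0) * SL2.mk 1 0 (g.1 1 0) 1 (by simp) *
      unipotent ((g.1 1 1 - 1) / g.1 1 0) := by
  have hd := g.det_eq
  simp only [SL2.ext_iff_entries, SL2.mul_apply, unipotent_apply_zero_zero,
    unipotent_apply_zero_one, unipotent_apply_one_zero, unipotent_apply_one_one,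
    SL2.mk_apply_zero_zero, SL2.mk_apply_zero_one, SL2.mk_apply_one_zero, SL2.mk_apply_one_one]
  refine ⟨?_, ?_, ?_, ?_⟩ <;> field_simp <;> first | ring1 | linear_combination -hd

theorem eq_top_of_unipotent_mem (N : Subgroup (SL2 F)) [N.Normal]
    (h : ∀ b : F, unipotent b ∈ N) : N = ⊤ := by
  have hlower (c : F) : SL2.mk 1 0 c 1 (by simp) ∈ N := by
    let w : SL2 F := SL2.mk 0 1 (-1) 0 (by simp)
    have hw : SL2.mk 1 0 c 1 (by simp) = w * unipotent (-c) * w⁻¹ := by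
      rw [eq_mul_inv_iff_mul_eq]
      simp [SL2.ext_iff_entries, SL2.mul_apply, w]
    exact hw ▸ ‹N.Normal›.conj_mem _ (h _) _
  have hne (g : SL2 F) (hc : g.1 1 0 ≠ 0) : g ∈ N := by
    rw [eq_unipotent_mul_mul_unipotent hc]
    exact N.mul_mem (N.mul_mem (h _) (hlower _)) (h _)
  refine eq_top_iff.2 fun g _ => ?_
  by_cases hc : g.1 1 0 = 0
  · have hd := g.det_eq
    rw [hc, mul_zero, sub_zero] at hd
    refine (N.mul_mem_cancel_right (hlower 1)).1 (hne _ ?_)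
    simpa [SL2.mul_apply, hc] using right_ne_zero_of_mul_eq_one hd
  · exact hne g hc

theorem not_isConj_unipotent {ε : F} (hε : ¬ IsSquare ε) :
    ¬ IsConj (unipotent (1 : F)) (unipotent ε) := by
  intro h
  obtain ⟨c, hc⟩ := isConj_iff.1 h
  rw [mul_inv_eq_iff_eq_mul, SL2.ext_iff_entries] at hc
  simp only [SL2.mul_apply, unipotent_apply_zero_zero, unipotent_apply_zero_one,
    unipotent_apply_one_zero, unipotent_apply_one_one] at hc
  obtain ⟨h00, h01, -, -⟩ := hc
  have hc0 : c.1 1 0 = 0 :=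
    (mul_eq_zero.1 (by linear_combination -h00 : ε * c.1 1 0 = 0)).resolve_left
      (ne_zero_of_not_isSquare hε)
  have hd : ε * c.1 1 1 * c.1 1 1 = 1 := by
    linear_combination c.det_eq - c.1 1 1 * h01 + c.1 0 1 * hc0
  refine hε ⟨(c.1 1 1)⁻¹, ?_⟩
  have : c.1 1 1 ≠ 0 := right_ne_zero_of_mul_eq_one hd
  field_simp
  linear_combination hd

end Group

section Card

variable {F : Type*} [Field F]

theorem upper_inj {a a' : Fˣ} {b b' : F} : upper a b = upper a' b' ↔ a = a' ∧ b = b' := by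
  refine ⟨fun h => ?_, fun ⟨ha, hb⟩ => ha ▸ hb ▸ rfl⟩
  rw [SL2.ext_iff_entries] at h
  exact ⟨Units.ext h.1, h.2.1⟩

theorem commute_unipotent_iff {k : SL2 F} {b : F} (hb : b ≠ 0) :
    Commute k (unipotent b) ↔ ∃ a c, (a = 1 ∨ a = -1) ∧ upper a c = k := by
  constructor
  · intro h
    have h : k * unipotent b = unipotent b * k := h
    simp only [SL2.ext_iff_entries, SL2.mul_apply, unipotent_apply_zero_zero,
      unipotent_apply_zero_one, unipotent_apply_one_zero, unipotent_apply_one_one] at h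
    have hc : k.1 1 0 = 0 := by simpa [hb] using h.1
    have had : k.1 0 0 = k.1 1 1 := mul_right_cancel₀ hb (by linear_combination h.2.1)
    have hd := k.det_eq
    rw [hc, ← had, mul_zero, sub_zero] at hd
    have ha : k.1 0 0 = 1 ∨ k.1 0 0 = -1 := mul_self_eq_one_iff.1 hd
    refine ⟨Units.mkOfMulEqOne _ _ hd, k.1 0 1, by simpa [Units.ext_iff] using ha, ?_⟩
    simp [SL2.ext_iff_entries, hc, ← had, inv_eq_of_mul_eq_one_right hd]
  · rintro ⟨a, c, rfl | rfl, rfl⟩ <;>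
      simp [commute_iff_eq, SL2.ext_iff_entries, SL2.mul_apply, add_comm]

variable [Fintype F]

open scoped Classical in
instance SL2.instFintype : Fintype (SL2 F) := Fintype.ofFinite _

open scoped Classical in
/-- The Bruhat decomposition, as a parametrization of `SL₂(F)`: a matrix with lower left entry
`c ≠ 0` is determined by its remaining diagonal entries and `c`, the others are upper triangular. -/
def bruhat : SL2 F ≃ (F × Fˣ × F) ⊕ (Fˣ × F) where
  toFun g := if hc : g.1 1 0 = 0 then
      .inr (Units.mkOfMulEqOne (g.1 0 0) (g.1 1 1) (by simpa [hc] using g.det_eq), g.1 0 1)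
    else .inl (g.1 0 0, Units.mk0 (g.1 1 0) hc, g.1 1 1)
  invFun := Sum.elim
    (fun p => SL2.mk p.1 ((p.1 * p.2.2 - 1) / p.2.1) p.2.1 p.2.2 (by simp))
    (fun p => upper p.1 p.2)
  left_inv g := by
    have hd := g.det_eq
    by_cases hc : g.1 1 0 = 0
    · have hd : g.1 0 0 * g.1 1 1 = 1 := by simpa [hc] using hd
      simpa [SL2.ext_iff_entries, hc] using inv_eq_of_mul_eq_one_right hd
    · simp only [hc, dite_false, Sum.elim_inl, SL2.ext_iff_entries, SL2.mk_apply_zero_zero,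
        SL2.mk_apply_zero_one, SL2.mk_apply_one_zero, SL2.mk_apply_one_one, Units.val_mk0,
        true_and, and_true]
      field_simp
      linear_combination hd
  right_inv p := by
    rcases p with ⟨a, c, d⟩ | ⟨a, b⟩
    · simp
    · simp [Units.ext_iff]

theorem card_SL2 : (Fintype.card (SL2 F) : ℤ) =
    Fintype.card F * ((Fintype.card F : ℤ) ^ 2 - 1) := by
  classical
  rw [Fintype.card_congr bruhat]
  simp only [Fintype.card_sum, Fintype.card_prod, Fintype.card_units]
  push_cast [Nat.cast_sub (Fintype.card_pos (α := F))]
  ring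

open scoped Classical in
theorem card_trace_eq_two :
    (Finset.univ.filter fun g : SL2 F => g.1.trace = 2).card = Fintype.card F ^ 2 := by
  have h0 (a : F) (c : Fˣ) (d : F) : (bruhat.symm (.inl (a, c, d))).1.trace = a + d :=
    Matrix.trace_fin_two _
  have h1 (a : Fˣ) (b : F) : (bruhat.symm (.inr (a, b))).1.trace = 2 ↔ a = 1 :=
    trace_upper_eq_two_iff
  rw [Finset.card_filter, ← bruhat.symm.sum_comp]
  simp only [Fintype.sum_sum_type, Fintype.sum_prod_type, h0, h1, ← eq_sub_iff_add_eq',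
    Finset.sum_ite_eq', Finset.mem_univ, if_true, Finset.sum_const, Finset.card_univ,
    Fintype.card_units, smul_eq_mul, mul_one, Finset.sum_comm (t := (Finset.univ : Finset F))]
  zify [Fintype.card_pos (α := F)]
  ring

open scoped Classical in
theorem card_centralizer_unipotent (h2 : (2 : F) ≠ 0) {b : F} (hb : b ≠ 0) :
    (Finset.univ.filter fun k : SL2 F => k * unipotent b * k⁻¹ = unipotent b).card =
      2 * Fintype.card F := by
  have hne : (1 : Fˣ) ≠ -1 := fun h => h2 (by
    have h' : (1 : F) = -1 := congrArg Units.val h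
    linear_combination h')
  have himage : (Finset.univ.filter fun k : SL2 F => k * unipotent b * k⁻¹ = unipotent b) =
      (({1, -1} : Finset Fˣ) ×ˢ (Finset.univ : Finset F)).image fun p => upper p.1 p.2 := by
    ext k
    rw [Finset.mem_filter_univ, mul_inv_eq_iff_eq_mul, ← commute_iff_eq, commute_unipotent_iff hb]
    simp
  rw [himage, Finset.card_image_of_injective _ fun p p' h => Prod.ext_iff.2 (upper_inj.1 h),
    Finset.card_product, Finset.card_pair hne, Finset.card_univ]

end Card

theorem ringChar_ne_two {F : Type*} [Field F] (h2 : (2 : F) ≠ 0) : ringChar F ≠ 2 := fun h =>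
  h2 (by simpa [h] using CharP.cast_eq_zero F (ringChar F))

section QuadraticCharacter

variable {F : Type*} [Field F] [Fintype F]

open scoped Classical in
/-- The quadratic character of a finite field, with complex values. -/
def chi : MulChar F ℂ := (quadraticChar F).ringHomComp (Int.castRingHom ℂ)

open scoped Classical in
theorem chi_apply (a : F) : chi a = ((quadraticChar F a : ℤ) : ℂ) := rfl

theorem chi_zero : chi (0 : F) = 0 := MulChar.map_zero _

theorem chi_mul_self {a : F} (ha : a ≠ 0) : chi a * chi a = 1 := by
  classical
  rw [chi_apply, ← Int.cast_mul, ← pow_two, quadraticChar_sq_one ha, Int.cast_one]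

theorem chi_ne_zero {a : F} (ha : a ≠ 0) : chi a ≠ 0 :=
  left_ne_zero_of_mul_eq_one (chi_mul_self ha)

theorem chi_inv (a : F) : chi a⁻¹ = chi a := by
  by_cases ha : a = 0
  · rw [ha, inv_zero]
  · apply mul_left_cancel₀ (chi_ne_zero ha)
    rw [chi_mul_self ha, ← map_mul, mul_inv_cancel₀ ha, map_one]

theorem chi_div (a b : F) : chi (a / b) = chi a * chi b := by
  rw [div_eq_mul_inv, map_mul, chi_inv]

theorem chi_sq {a : F} (ha : a ≠ 0) : chi (a ^ 2) = 1 := by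
  rw [pow_two, map_mul, chi_mul_self ha]

theorem chi_eq_one_or {a : F} (ha : a ≠ 0) : chi a = 1 ∨ chi a = -1 :=
  mul_self_eq_one_iff.1 (chi_mul_self ha)

theorem star_chi (a : F) : star (chi a) = chi a := by
  rw [chi_apply, star_intCast]

theorem chi_eq_neg_one {a : F} (ha : ¬ IsSquare a) : chi a = -1 := by
  classical
  rw [chi_apply, quadraticChar_neg_one_iff_not_isSquare.2 ha, Int.cast_neg, Int.cast_one]

theorem isSquare_of_chi_eq_one {a : F} (h : chi a = 1) : IsSquare a := by
  by_contra hc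
  rw [chi_eq_neg_one hc] at h
  norm_num at h

theorem chi_ne_one (h2 : (2 : F) ≠ 0) : (chi : MulChar F ℂ) ≠ 1 := by
  classical
  obtain ⟨a, ha⟩ := quadraticChar_exists_neg_one (ringChar_ne_two h2)
  intro h
  have ha0 : a ≠ 0 := by
    rintro rfl
    simp at ha
  have hchi : chi a = 1 := by rw [h, MulChar.one_apply ha0.isUnit]
  rw [chi_apply, ha] at hchi
  norm_num at hchi

theorem sum_comp_sq (h2 : (2 : F) ≠ 0) (f : F → ℂ) :
    ∑ x, f (x ^ 2) = ∑ y, (chi y + 1) * f y := by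
  classical
  rw [← Finset.sum_fiberwise (g := fun x : F => x ^ 2)]
  refine Finset.sum_congr rfl fun y _ => ?_
  have hcard : ((Finset.univ.filter fun x : F => x ^ 2 = y).card : ℂ) = chi y + 1 := by
    have hsqrts := quadraticChar_card_sqrts (ringChar_ne_two h2) y
    rw [Set.toFinset_ofFinset] at hsqrts
    rw [chi_apply]
    exact_mod_cast hsqrts
  rw [← hcard, ← nsmul_eq_mul, ← Finset.sum_const]
  exact Finset.sum_congr rfl fun x hx => by rw [(Finset.mem_filter.1 hx).2]

variable {ψ : AddChar F ℂ}

theorem sum_addChar_mul_sq (h2 : (2 : F) ≠ 0) (hψ : ψ ≠ 1) {a : F} (ha : a ≠ 0) :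
    ∑ x, ψ (a * x ^ 2) = chi a * gaussSum chi ψ := by
  classical
  have hlin : ∑ y, ψ (a * y) = 0 := by
    have hsum := AddChar.sum_mulShift a (AddChar.IsPrimitive.of_ne_one hψ)
    rw [if_neg ha] at hsum
    simpa [mul_comm] using hsum
  have hgauss : chi a * gaussSum chi (ψ.mulShift a) = gaussSum chi ψ :=
    gaussSum_mulShift chi ψ (Units.mk0 a ha)
  rw [sum_comp_sq h2 fun y => ψ (a * y), ← hgauss, ← mul_assoc, chi_mul_self ha, one_mul]
  simp only [add_mul, one_mul, Finset.sum_add_distrib, hlin, add_zero]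
  rfl

theorem gaussSum_chi_mul_self (h2 : (2 : F) ≠ 0) (hψ : ψ ≠ 1) :
    gaussSum chi ψ * gaussSum chi ψ = chi (-1 : F) * Fintype.card F := by
  have hquad : (chi : MulChar F ℂ).IsQuadratic := fun a => by
    by_cases ha : a = 0
    · exact Or.inl (by rw [ha, chi_zero])
    · exact Or.inr (chi_eq_one_or ha)
  rw [← pow_two]
  exact gaussSum_sq (chi_ne_one h2) hquad (AddChar.IsPrimitive.of_ne_one hψ)

theorem gaussSum_chi_ne_zero (h2 : (2 : F) ≠ 0) (hψ : ψ ≠ 1) : gaussSum chi ψ ≠ 0 := by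
  refine left_ne_zero_of_mul (b := gaussSum chi ψ) ?_
  rw [gaussSum_chi_mul_self h2 hψ]
  exact mul_ne_zero (chi_ne_zero (neg_ne_zero.2 one_ne_zero))
    (Nat.cast_ne_zero.2 Fintype.card_ne_zero)

theorem gaussSum_chi_mul_star (h2 : (2 : F) ≠ 0) (hψ : ψ ≠ 1) :
    gaussSum chi ψ * star (gaussSum chi ψ) = Fintype.card F := by
  have hchi : ‖chi (-1 : F)‖ = 1 := by
    rcases chi_eq_one_or (a := (-1 : F)) (neg_ne_zero.2 one_ne_zero) with h | h <;> simp [h]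
  have hnorm := congrArg norm (gaussSum_chi_mul_self h2 hψ)
  rw [norm_mul, norm_mul, hchi, one_mul, Complex.norm_natCast] at hnorm
  have hsq := Complex.mul_conj (gaussSum chi ψ)
  rw [Complex.normSq_eq_norm_sq, pow_two, hnorm] at hsq
  exact_mod_cast hsq

end QuadraticCharacter

section Weil

variable {F : Type*} [Field F] [Fintype F] {ψ : AddChar F ℂ}

/-- The quadratic phase `(a x² - 2 x y + d y²) / (2 c)` in the kernel by which the matrix
`(a b; c d)`, `c ≠ 0`, acts in the Weil representation. -/
def weilPhase (g : SL2 F) (x y : F) : F :=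
  (g.1 0 0 * x ^ 2 - 2 * x * y + g.1 1 1 * y ^ 2) / (2 * g.1 1 0)

open scoped Classical in
variable (ψ) in
/-- The kernel by which a matrix acts in the Weil representation of `SL₂(F)` on functions on `F`
attached to the additive character `ψ`. -/
def weilKernel (g : SL2 F) : Matrix F F ℂ := Matrix.of fun x y =>
  if g.1 1 0 = 0 then
    if y = g.1 0 0 * x then chi (g.1 0 0) * ψ (g.1 0 0 * g.1 0 1 * x ^ 2 / 2) else 0
  else chi (2 * g.1 1 0) * (gaussSum chi ψ)⁻¹ * ψ (weilPhase g x y)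

theorem weilKernel_of_eq {g : SL2 F} (h : g.1 1 0 = 0) (x y : F) [Decidable (y = g.1 0 0 * x)] :
    weilKernel ψ g x y =
      if y = g.1 0 0 * x then chi (g.1 0 0) * ψ (g.1 0 0 * g.1 0 1 * x ^ 2 / 2) else 0 := by
  rw [weilKernel, Matrix.of_apply, if_pos h]
  congr

theorem weilKernel_of_ne {g : SL2 F} (h : g.1 1 0 ≠ 0) (x y : F) :
    weilKernel ψ g x y = chi (2 * g.1 1 0) * (gaussSum chi ψ)⁻¹ * ψ (weilPhase g x y) := by
  rw [weilKernel, Matrix.of_apply, if_neg h]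

theorem weilKernel_one [DecidableEq F] : weilKernel ψ (1 : SL2 F) = 1 := by
  ext x y
  rw [weilKernel_of_eq (by simp)]
  simp [Matrix.one_apply, eq_comm]

theorem weilKernel_mul_of_left (h2 : (2 : F) ≠ 0) {g : SL2 F} (hg : g.1 1 0 = 0) (h : SL2 F) :
    weilKernel ψ (g * h) = weilKernel ψ g * weilKernel ψ h := by
  classical
  have dg : g.1 0 0 * g.1 1 1 = 1 := by simpa [hg] using g.det_eq
  have ha : g.1 0 0 ≠ 0 := left_ne_zero_of_mul_eq_one dg
  have hd : g.1 1 1 = (g.1 0 0)⁻¹ := eq_inv_of_mul_eq_one_right dg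
  ext x z
  simp only [Matrix.mul_apply, weilKernel_of_eq hg, ite_mul, zero_mul, Finset.sum_ite_eq',
    Finset.mem_univ, if_true]
  by_cases hh : h.1 1 0 = 0
  · have dh : h.1 0 0 * h.1 1 1 = 1 := by simpa [hh] using h.det_eq
    rw [weilKernel_of_eq hh, weilKernel_of_eq (by simp [SL2.mul_apply, hg, hh])]
    simp only [SL2.mul_apply, hh, mul_zero, add_zero, mul_ite, mul_mul_mul_comm _ (ψ _),
      ← map_mul chi, ← AddChar.map_add_eq_mul, mul_left_comm (h.1 0 0), ← mul_assoc (g.1 0 0)]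
    congr 3
    field_simp
    linear_combination g.1 0 1 * x ^ 2 * dh
  · have hc : (g * h).1 1 0 = (g.1 0 0)⁻¹ * h.1 1 0 := by rw [SL2.mul_apply, hg, hd]; ring
    have hphase : weilPhase (g * h) x z =
        g.1 0 0 * g.1 0 1 * x ^ 2 / 2 + weilPhase h (g.1 0 0 * x) z := by
      simp only [weilPhase, hc, SL2.mul_apply, hg, hd, zero_mul, zero_add]
      field_simp
      ring
    rw [weilKernel_of_ne hh, weilKernel_of_ne (by rw [hc]; exact mul_ne_zero (inv_ne_zero ha) hh),
      hphase, AddChar.map_add_eq_mul, hc, mul_left_comm 2, map_mul, chi_inv]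
    ring

theorem weilKernel_mul_of_right (h2 : (2 : F) ≠ 0) {g h : SL2 F} (hg : g.1 1 0 ≠ 0)
    (hh : h.1 1 0 = 0) : weilKernel ψ (g * h) = weilKernel ψ g * weilKernel ψ h := by
  classical
  have dh : h.1 0 0 * h.1 1 1 = 1 := by simpa [hh] using h.det_eq
  have ha : h.1 0 0 ≠ 0 := left_ne_zero_of_mul_eq_one dh
  have hc : (g * h).1 1 0 = g.1 1 0 * h.1 0 0 := by rw [SL2.mul_apply, hh]; ring
  ext x z
  have hphase : weilPhase (g * h) x z =
      weilPhase g x (z / h.1 0 0) + h.1 0 0 * h.1 0 1 * (z / h.1 0 0) ^ 2 / 2 := by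
    simp only [weilPhase, hc, SL2.mul_apply, hh, eq_inv_of_mul_eq_one_right dh]
    field_simp
    ring
  have hz (y : F) : z = h.1 0 0 * y ↔ y = z / h.1 0 0 := by
    rw [eq_div_iff ha, mul_comm, eq_comm]
  simp only [Matrix.mul_apply, weilKernel_of_eq hh, hz, mul_ite, mul_zero, Finset.sum_ite_eq',
    Finset.mem_univ, if_true]
  rw [weilKernel_of_ne hg, weilKernel_of_ne (by rw [hc]; exact mul_ne_zero hg ha), hphase,
    AddChar.map_add_eq_mul, hc, ← mul_assoc 2, map_mul chi (2 * _)]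
  ring

theorem weilKernel_mul_apply_of_ne (h2 : (2 : F) ≠ 0) {g h : SL2 F} (hg : g.1 1 0 ≠ 0)
    (hh : h.1 1 0 ≠ 0) (x z : F) : (weilKernel ψ g * weilKernel ψ h) x z =
      chi (g.1 1 0 * h.1 1 0) * (gaussSum chi ψ * gaussSum chi ψ)⁻¹ *
        ∑ y, ψ (weilPhase g x y + weilPhase h y z) := by
  rw [Matrix.mul_apply, Finset.mul_sum]
  refine Finset.sum_congr rfl fun y _ => ?_
  rw [weilKernel_of_ne hg, weilKernel_of_ne hh, AddChar.map_add_eq_mul, mul_inv]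
  simp only [map_mul]
  linear_combination (chi (g.1 1 0) * chi (h.1 1 0) * (gaussSum chi ψ)⁻¹ * (gaussSum chi ψ)⁻¹ *
    ψ (weilPhase g x y) * ψ (weilPhase h y z)) * chi_mul_self h2

theorem weilKernel_mul_inv [DecidableEq F] (h2 : (2 : F) ≠ 0) (hψ : ψ ≠ 1) {g : SL2 F}
    (hg : g.1 1 0 ≠ 0) : weilKernel ψ g * weilKernel ψ g⁻¹ = 1 := by
  have hinv : g⁻¹.1 0 0 = g.1 1 1 ∧ g⁻¹.1 1 0 = -g.1 1 0 ∧ g⁻¹.1 1 1 = g.1 0 0 := by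
    simp [Matrix.SpecialLinearGroup.coe_inv, Matrix.adjugate_fin_two]
  ext x z
  have hphase (y : F) : weilPhase g x y + weilPhase g⁻¹ y z =
      g.1 0 0 * (x ^ 2 - z ^ 2) / (2 * g.1 1 0) + y * ((z - x) / g.1 1 0) := by
    simp only [weilPhase, hinv]
    field_simp
    ring
  rw [weilKernel_mul_apply_of_ne h2 hg (by rw [hinv.2.1]; exact neg_ne_zero.2 hg), hinv.2.1]
  simp only [hphase, AddChar.map_add_eq_mul, ← Finset.mul_sum,
    AddChar.sum_mulShift _ (AddChar.IsPrimitive.of_ne_one hψ)]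
  by_cases hxz : x = z
  · have hq : (Fintype.card F : ℂ) ≠ 0 := card_cast_ne_zero
    have hchi : chi (-1 : F) ≠ 0 := chi_ne_zero (neg_ne_zero.2 one_ne_zero)
    rw [gaussSum_chi_mul_self h2 hψ, mul_neg, ← pow_two, neg_eq_neg_one_mul, map_mul, chi_sq hg]
    subst hxz
    simp only [sub_self, zero_div, mul_zero, AddChar.map_zero_eq_one, one_mul, if_true]
    field_simp
    rw [Matrix.one_apply_eq]
  · rw [if_neg (div_ne_zero (sub_ne_zero.2 (Ne.symm hxz)) hg), Matrix.one_apply_ne hxz,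
      Nat.cast_zero, mul_zero, mul_zero]

-- Completing the square turns the sum over the intermediate variable into a Gauss sum.
theorem weilKernel_mul_of_ne (h2 : (2 : F) ≠ 0) (hψ : ψ ≠ 1) {g h : SL2 F} (hg : g.1 1 0 ≠ 0)
    (hh : h.1 1 0 ≠ 0) (hgh : (g * h).1 1 0 ≠ 0) :
    weilKernel ψ (g * h) = weilKernel ψ g * weilKernel ψ h := by
  ext x z
  have hphase (y : F) : weilPhase g x y + weilPhase h y z = weilPhase (g * h) x z +
      (g * h).1 1 0 / (2 * (g.1 1 0 * h.1 1 0)) *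
        (y - (x * h.1 1 0 + z * g.1 1 0) / (g * h).1 1 0) ^ 2 := by
    rw [SL2.mul_apply] at hgh
    simp only [weilPhase, SL2.mul_apply]
    field_simp
    linear_combination (x ^ 2 * h.1 1 0 ^ 2) * g.det_eq + (z ^ 2 * g.1 1 0 ^ 2) * h.det_eq
  have hsum (r s : F) (hr : r ≠ 0) : ∑ y, ψ (r * (y - s) ^ 2) = chi r * gaussSum chi ψ := by
    rw [← sum_addChar_mul_sq h2 hψ hr]
    exact (Equiv.subRight s).sum_comp fun y => ψ (r * y ^ 2)
  rw [weilKernel_mul_apply_of_ne h2 hg hh, weilKernel_of_ne hgh]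
  simp only [hphase, AddChar.map_add_eq_mul, ← Finset.mul_sum]
  rw [hsum _ _ (div_ne_zero hgh (mul_ne_zero h2 (mul_ne_zero hg hh))), chi_div, map_mul chi 2,
    map_mul chi 2]
  have hG := gaussSum_chi_ne_zero h2 hψ
  field_simp
  linear_combination -(chi (2 : F) * chi ((g * h).1 1 0) * ψ (weilPhase (g * h) x z)) *
    chi_mul_self (mul_ne_zero hg hh)

theorem weilKernel_mul (h2 : (2 : F) ≠ 0) (hψ : ψ ≠ 1) (g h : SL2 F) :
    weilKernel ψ (g * h) = weilKernel ψ g * weilKernel ψ h := by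
  classical
  by_cases hg : g.1 1 0 = 0
  · exact weilKernel_mul_of_left h2 hg h
  by_cases hh : h.1 1 0 = 0
  · exact weilKernel_mul_of_right h2 hg hh
  by_cases hgh : (g * h).1 1 0 = 0
  · have hg' : g⁻¹.1 1 0 ≠ 0 := by
      simpa [Matrix.SpecialLinearGroup.coe_inv, Matrix.adjugate_fin_two] using hg
    rw [← inv_mul_cancel_left g h, mul_inv_cancel_left, weilKernel_mul_of_right h2 hg' hgh,
      ← mul_assoc, weilKernel_mul_inv h2 hψ hg, one_mul]
  · exact weilKernel_mul_of_ne h2 hψ hg hh hgh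

/-- The Weil representation of `SL₂(F)` on functions on `F`, in matrix form. -/
def weil [DecidableEq F] (h2 : (2 : F) ≠ 0) (hψ : ψ ≠ 1) : SL2 F →* Matrix F F ℂ where
  toFun := weilKernel ψ
  map_one' := weilKernel_one
  map_mul' := weilKernel_mul h2 hψ

end Weil

section CentralCharacter

variable {F : Type*} [Field F]

theorem Irrep.exists_sign (x : Irrep (SL2 F)) :
    ∃ s : ℤˣ, ∀ g, x.character (-g) = s * x.character g := by
  induction x using Quotient.inductionOn with | _ V =>
  have hV := V.2
  obtain ⟨c, hc⟩ := exists_smul_of_commute V.1 (V.1.ρ (-1)) fun g => by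
    change V.1.ρ (-1) * V.1.ρ g = V.1.ρ g * V.1.ρ (-1)
    rw [← map_mul, ← map_mul, mul_neg, neg_mul, mul_one, one_mul]
  have hneg (g : SL2 F) : V.1.character (-g) = c * V.1.character g := by
    have hρ : V.1.ρ (-g) = c • V.1.ρ g := by
      rw [← neg_one_mul, map_mul, hc, smul_mul_assoc, ← Module.End.one_eq_id, one_mul]
    rw [FDRep.character, hρ, map_smul, smul_eq_mul, FDRep.character]
  have hdim : (Module.finrank ℂ V.1 : ℂ) ≠ 0 :=
    Nat.cast_ne_zero.2 (Irrep.dim_pos (⟦V⟧ : Irrep (SL2 F))).ne'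
  have hc : c * c = 1 := by
    have h := hneg (-1)
    rw [neg_neg, hneg, ← mul_assoc, FDRep.char_one] at h
    exact mul_right_cancel₀ hdim (by rw [one_mul, ← h])
  obtain ⟨s, rfl⟩ : ∃ s : ℤˣ, (s : ℂ) = c := by
    rcases mul_self_eq_one_iff.1 hc with rfl | rfl
    · exact ⟨1, by norm_num⟩
    · exact ⟨-1, by norm_num⟩
  exact ⟨s, hneg⟩

end CentralCharacter

section WeilCharacter

variable {F : Type*} [Field F] [Fintype F]

/-- The character of the Weil representation attached to `ψ`. -/
def weilCharacter (ψ : AddChar F ℂ) (g : SL2 F) : ℂ := (weilKernel ψ g).trace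

variable {ψ : AddChar F ℂ}

theorem weilCharacter_eq_of_isConj (h2 : (2 : F) ≠ 0) (hψ : ψ ≠ 1) {g h : SL2 F}
    (hc : IsConj g h) : weilCharacter ψ g = weilCharacter ψ h := by
  classical
  obtain ⟨c, rfl⟩ := isConj_iff.1 hc
  rw [weilCharacter, weilCharacter, weilKernel_mul h2 hψ, Matrix.trace_mul_comm,
    ← weilKernel_mul h2 hψ, inv_mul_cancel_left]

theorem weilCharacter_one : weilCharacter ψ (1 : SL2 F) = Fintype.card F := by
  classical
  rw [weilCharacter, weilKernel_one, Matrix.trace_one]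

theorem weilCharacter_of_trace_ne_two (h2 : (2 : F) ≠ 0) (hψ : ψ ≠ 1) {g : SL2 F}
    (ht : g.1.trace ≠ 2) : weilCharacter ψ g = chi (g.1.trace - 2) := by
  classical
  rw [weilCharacter, Matrix.trace]
  simp only [Matrix.diag_apply]
  by_cases hc : g.1 1 0 = 0
  · have hd : g.1 0 0 * g.1 1 1 = 1 := by simpa [hc] using g.det_eq
    have ha : g.1 0 0 ≠ 0 := left_ne_zero_of_mul_eq_one hd
    have htr : g.1.trace - 2 = (g.1 0 0 - 1) ^ 2 / g.1 0 0 := by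
      rw [Matrix.trace_fin_two, eq_inv_of_mul_eq_one_right hd]
      field_simp
      ring
    have ha1 : g.1 0 0 - 1 ≠ 0 := fun h => ht (sub_eq_zero.1 (by rw [htr, h]; simp))
    have hfix (x : F) : x = g.1 0 0 * x ↔ x = 0 := by
      rw [← sub_eq_zero, ← neg_eq_zero, neg_sub, ← sub_one_mul, mul_eq_zero, or_iff_right ha1]
    simp only [weilKernel_of_eq hc, hfix, Finset.sum_ite_eq', Finset.mem_univ, if_true]
    rw [htr, chi_div, chi_sq ha1]
    simp
  · have hphase (x : F) : weilPhase g x x = (g.1.trace - 2) / (2 * g.1 1 0) * x ^ 2 := by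
      rw [weilPhase, Matrix.trace_fin_two]
      ring
    simp only [weilKernel_of_ne hc, hphase]
    rw [← Finset.mul_sum, sum_addChar_mul_sq h2 hψ
      (div_ne_zero (sub_ne_zero.2 ht) (mul_ne_zero h2 hc)), chi_div]
    have hG := gaussSum_chi_ne_zero h2 hψ
    field_simp
    linear_combination chi (g.1.trace - 2) * chi_mul_self (mul_ne_zero h2 hc)

theorem weilCharacter_unipotent (h2 : (2 : F) ≠ 0) (hψ : ψ ≠ 1) {b : F} (hb : b ≠ 0) :
    weilCharacter ψ (unipotent b) = chi b * (chi (2 : F) * gaussSum chi ψ) := by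
  classical
  have hx (x : F) : b * x ^ 2 / 2 = b / 2 * x ^ 2 := by ring
  rw [weilCharacter, Matrix.trace]
  simp only [Matrix.diag_apply, weilKernel_of_eq (unipotent_apply_one_zero b),
    unipotent_apply_zero_zero, unipotent_apply_zero_one, one_mul, if_true, map_one, hx]
  rw [sum_addChar_mul_sq h2 hψ (div_ne_zero hb h2), chi_div, mul_assoc]

theorem weilCharacter_neg_unipotent (h2 : (2 : F) ≠ 0) (hψ : ψ ≠ 1) (b : F) :
    chi (-1 : F) * weilCharacter ψ (-unipotent b) = 1 := by
  have htr : (-unipotent b).1.trace = -2 := by rw [trace_neg, trace_unipotent]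
  have hne : (-unipotent b).1.trace ≠ 2 := fun h =>
    mul_ne_zero h2 h2 (by linear_combination htr - h)
  rw [weilCharacter_of_trace_ne_two h2 hψ hne, htr, ← map_mul,
    show (-1 : F) * (-2 - 2) = 2 ^ 2 by ring, chi_sq h2]

open scoped Classical in
theorem weilCharacter_mul_star (h2 : (2 : F) ≠ 0) (hψ : ψ ≠ 1) (g : SL2 F) :
    weilCharacter ψ g * star (weilCharacter ψ g) =
      1 + (if g.1.trace = 2 then (Fintype.card F : ℂ) - 1 else 0) +
        (if g = 1 then (Fintype.card F : ℂ) ^ 2 - Fintype.card F else 0) := by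
  by_cases hg : g = 1
  · rw [hg, weilCharacter_one, if_pos trace_one, if_pos rfl, star_natCast]
    ring
  rw [if_neg hg, add_zero]
  split_ifs with ht
  · obtain ⟨b, hb, hc⟩ := exists_isConj_unipotent ht hg
    rw [weilCharacter_eq_of_isConj h2 hψ hc, weilCharacter_unipotent h2 hψ hb, star_mul', star_mul',
      star_chi, star_chi]
    linear_combination (gaussSum chi ψ * star (gaussSum chi ψ)) *
      ((chi (2 : F)) ^ 2 * chi_mul_self hb + chi_mul_self h2) + gaussSum_chi_mul_star h2 hψ
  · rw [weilCharacter_of_trace_ne_two h2 hψ ht, star_chi, chi_mul_self (sub_ne_zero.2 ht),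
      add_zero]

theorem sum_weilCharacter_mul_star (h2 : (2 : F) ≠ 0) (hψ : ψ ≠ 1) :
    ∑ g, weilCharacter ψ g * star (weilCharacter ψ g) = Fintype.card (SL2 F) * 2 := by
  classical
  have hcard : (Fintype.card (SL2 F) : ℂ) =
      Fintype.card F * ((Fintype.card F : ℂ) ^ 2 - 1) := by
    exact_mod_cast congrArg (Int.cast : ℤ → ℂ) card_SL2
  simp only [weilCharacter_mul_star h2 hψ, Finset.sum_add_distrib, ← Finset.sum_filter,
    Finset.sum_const, card_trace_eq_two, Finset.filter_eq', Finset.mem_univ, if_true,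
    Finset.card_singleton, Finset.card_univ, nsmul_eq_mul]
  push_cast
  linear_combination -hcard

end WeilCharacter

section CentralSign

variable {F : Type*} [Field F]

/-- The sign by which `-1 ∈ SL₂(F)` acts in an irreducible representation. -/
def Irrep.centralSign (x : Irrep (SL2 F)) : ℤˣ := x.exists_sign.choose

theorem Irrep.character_neg (x : Irrep (SL2 F)) (g : SL2 F) :
    x.character (-g) = x.centralSign * x.character g := x.exists_sign.choose_spec g

theorem half_add_mul_neg_eq_sum_filter [Finite F] {φ : SL2 F → ℂ} {c : Irrep (SL2 F) → ℂ}
    (h : ∀ g, φ g = ∑ x, c x * x.character g) (v : ℤˣ) (g : SL2 F) :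
    (φ g + v * φ (-g)) / 2 =
      ∑ x ∈ Finset.univ.filter (fun x => x.centralSign = v), c x * x.character g := by
  rw [h, h, Finset.mul_sum, ← Finset.sum_add_distrib, Finset.sum_div, Finset.sum_filter]
  refine Finset.sum_congr rfl fun x _ => ?_
  rw [x.character_neg]
  have hvv : (v : ℂ) * v = 1 := by exact_mod_cast Int.units_coe_mul_self v
  split_ifs with hv
  · rw [hv]
    linear_combination c x * x.character g / 2 * hvv
  · rw [Int.units_ne_iff_eq_neg.1 hv]
    push_cast
    linear_combination -(c x * x.character g / 2) * hvv

end CentralSign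

theorem exists_forall_sum_eq_of_sum_mul_self_eq_one {ι : Type*} {s : Finset ι} {m : ι → ℕ}
    (h : ∑ x ∈ s, m x * m x = 1) :
    ∃ x ∈ s, ∀ f : ι → ℂ, ∑ y ∈ s, (m y : ℂ) * f y = f x := by
  classical
  obtain ⟨x, hx, hmx⟩ := Finset.exists_ne_zero_of_sum_ne_zero (by rw [h]; exact one_ne_zero)
  rw [← Finset.add_sum_erase _ _ hx] at h
  have hone : m x * m x = 1 := by omega
  have hzero : ∑ y ∈ s.erase x, m y * m y = 0 := by omega
  refine ⟨x, hx, fun f => ?_⟩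
  rw [Finset.sum_eq_single_of_mem x hx fun y hy hyx => ?_, Nat.eq_one_of_mul_eq_one_right hone,
    Nat.cast_one, one_mul]
  rw [mul_self_eq_zero.1 (Finset.sum_eq_zero_iff.1 hzero y (Finset.mem_erase.2 ⟨hyx, hy⟩)),
    Nat.cast_zero, zero_mul]

section WeilConstituents

variable {F : Type*} [Field F] [Fintype F]

/-- The component of a class function `φ` on `SL₂(F)` on which `-1` acts by `σ · chi (-1)`. For the
Weil representation these are the even (`σ = 1`) and odd (`σ = -1`) functions on `F`. -/
def parityPart (σ : ℤˣ) (φ : SL2 F → ℂ) (g : SL2 F) : ℂ :=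
  (φ g + σ * (chi (-1 : F) * φ (-g))) / 2

theorem chi_neg_one_mul_self : chi (-1 : F) * chi (-1 : F) = 1 :=
  chi_mul_self (neg_ne_zero.2 one_ne_zero)

variable (F) in
theorem exists_units_eq_chi_neg_one : ∃ u : ℤˣ, (u : ℂ) = chi (-1 : F) := by
  rcases mul_self_eq_one_iff.1 (chi_neg_one_mul_self (F := F)) with h | h
  · exact ⟨1, by simp [h]⟩
  · exact ⟨-1, by simp [h]⟩

variable {ψ : AddChar F ℂ}

theorem parityPart_weilCharacter_one (h2 : (2 : F) ≠ 0) (hψ : ψ ≠ 1) (σ : ℤˣ) :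
    parityPart σ (weilCharacter ψ) 1 = (Fintype.card F + σ) / 2 := by
  have hneg := weilCharacter_neg_unipotent h2 hψ 0
  rw [unipotent_zero] at hneg
  rw [parityPart, weilCharacter_one, hneg, mul_one]

theorem parityPart_weilCharacter_unipotent (h2 : (2 : F) ≠ 0) (hψ : ψ ≠ 1) (σ : ℤˣ) {b : F}
    (hb : b ≠ 0) : parityPart σ (weilCharacter ψ) (unipotent b) =
      (chi b * (chi (2 : F) * gaussSum chi ψ) + σ) / 2 := by
  rw [parityPart, weilCharacter_unipotent h2 hψ hb, weilCharacter_neg_unipotent h2 hψ, mul_one]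

-- The Weil character has norm two and both of its parity components are nonzero, so each of them
-- is irreducible.
theorem exists_character_eq_parityPart (h2 : (2 : F) ≠ 0) (hψ : ψ ≠ 1) (σ : ℤˣ) :
    ∃ x : Irrep (SL2 F), ∀ g, x.character g = parityPart σ (weilCharacter ψ) g := by
  classical
  obtain ⟨u, hu⟩ := exists_units_eq_chi_neg_one F
  obtain ⟨V, hV⟩ := exists_fdRep_of_matrix (weil h2 hψ)
  obtain ⟨m, hm⟩ := exists_character_eq_sum V
  have hω (g : SL2 F) : weilCharacter ψ g = ∑ x, (m x : ℂ) * x.character g := by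
    rw [← hm, hV]
    rfl
  have hpart (τ : ℤˣ) (g : SL2 F) : parityPart τ (weilCharacter ψ) g =
      ∑ x ∈ Finset.univ.filter (fun x => x.centralSign = τ * u), (m x : ℂ) * x.character g := by
    rw [← half_add_mul_neg_eq_sum_filter hω, parityPart, ← hu]
    push_cast
    rw [mul_assoc]
  have hnorm : ∑ x, m x * m x = 2 := by
    have h := sum_mul_star_self_of_eq_sum hω
    rw [sum_weilCharacter_mul_star h2 hψ] at h
    simp only [star_natCast] at h
    exact_mod_cast (mul_left_cancel₀ card_cast_ne_zero h).symm
  have hpos (τ : ℤˣ) :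
      ∑ x ∈ Finset.univ.filter (fun x => x.centralSign = τ * u), m x * m x ≠ 0 := by
    intro h0
    have h1 := hpart τ 1
    rw [parityPart_weilCharacter_one h2 hψ, Finset.sum_eq_zero fun x hx => by
      rw [mul_self_eq_zero.1 (Finset.sum_eq_zero_iff.1 h0 x hx), Nat.cast_zero, zero_mul]] at h1
    have hq : (Fintype.card F : ℤ) + τ = 0 := by
      exact_mod_cast (div_eq_zero_iff.1 h1).resolve_right two_ne_zero
    have := Fintype.one_lt_card (α := F)
    rcases Int.units_eq_one_or τ with rfl | rfl <;> simp at hq <;> omega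
  have hsplit := Finset.sum_filter_add_sum_filter_not Finset.univ
    (fun x : Irrep (SL2 F) => x.centralSign = σ * u) fun x => m x * m x
  simp only [hnorm, ← ne_eq, Int.units_ne_iff_eq_neg, ← neg_mul] at hsplit
  have hone : ∑ x ∈ Finset.univ.filter (fun x => x.centralSign = σ * u), m x * m x = 1 := by
    have := hpos σ
    have := hpos (-σ)
    omega
  obtain ⟨x, -, hx⟩ := exists_forall_sum_eq_of_sum_mul_self_eq_one hone
  exact ⟨x, fun g => by rw [hpart, hx fun y => y.character g]⟩

end WeilConstituents

section Idempotent

variable {V : Type*} [AddCommGroup V] [Module ℂ V] [FiniteDimensional ℂ V]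

theorem trace_of_isIdempotentElem {e : V →ₗ[ℂ] V} (he : IsIdempotentElem e) :
    LinearMap.trace ℂ V e = Module.finrank ℂ (LinearMap.range e) :=
  (LinearMap.IsIdempotentElem.isProj_range _ he).trace

theorem mul_eq_smul_of_trace_eq_one {e : V →ₗ[ℂ] V} (he : IsIdempotentElem e)
    (h1 : LinearMap.trace ℂ V e = 1) {A : V →ₗ[ℂ] V} (hA : A * e = e * A) :
    A * e = LinearMap.trace ℂ V (A * e) • e := by
  have hrank : Module.finrank ℂ (LinearMap.range e) = 1 := by
    rw [trace_of_isIdempotentElem he] at h1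
    exact_mod_cast h1
  obtain ⟨⟨v, hv⟩, -, hspan⟩ := finrank_eq_one_iff'.1 hrank
  obtain ⟨l, hl⟩ : ∃ l : ℂ, A v = l • v := by
    obtain ⟨w, rfl⟩ := hv
    have hcomm : A (e w) = e (A w) := congrArg (fun f : V →ₗ[ℂ] V => f w) hA
    obtain ⟨l, hl⟩ := hspan ⟨e (A w), ⟨_, rfl⟩⟩
    exact ⟨l, hcomm.trans (congrArg Subtype.val hl).symm⟩
  have hAe : A * e = l • e := by
    ext w
    obtain ⟨c, hc⟩ := hspan ⟨e w, ⟨w, rfl⟩⟩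
    have hc' : c • v = e w := congrArg Subtype.val hc
    change A (e w) = l • e w
    rw [← hc', map_smul, hl, smul_comm]
  rw [hAe, map_smul, h1, smul_eq_mul, mul_one]

end Idempotent

section Unipotent

variable {F : Type*} [Field F] [Fintype F]

/-- The projector onto the `ψ⁻¹`-isotypic part for the upper unipotent subgroup. -/
def unipotentProj (V : FDRep ℂ (SL2 F)) (ψ : AddChar F ℂ) : V →ₗ[ℂ] V :=
  (Fintype.card F : ℂ)⁻¹ • ∑ b, ψ b • V.ρ (unipotent b)

variable (V : FDRep ℂ (SL2 F)) (ψ : AddChar F ℂ)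

theorem smul_rho_mul_unipotentProj (c : F) :
    ψ c • (V.ρ (unipotent c) * unipotentProj V ψ) = unipotentProj V ψ := by
  rw [unipotentProj, mul_smul_comm, smul_comm, Finset.mul_sum, Finset.smul_sum]
  congr 1
  refine Fintype.sum_equiv (Equiv.addLeft c) _ _ fun b => ?_
  rw [mul_smul_comm, ← map_mul, unipotent_mul, smul_smul, ← AddChar.map_add_eq_mul]
  rfl

theorem isIdempotentElem_unipotentProj : IsIdempotentElem (unipotentProj V ψ) := by
  unfold IsIdempotentElem
  conv_lhs => enter [1]; rw [unipotentProj]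
  rw [smul_mul_assoc, Finset.sum_mul]
  simp only [smul_mul_assoc, smul_rho_mul_unipotentProj]
  rw [Finset.sum_const, Finset.card_univ, ← Nat.cast_smul_eq_nsmul ℂ, smul_smul,
    inv_mul_cancel₀ card_cast_ne_zero, one_smul]

theorem trace_mul_unipotentProj (g : SL2 F) : LinearMap.trace ℂ V (V.ρ g * unipotentProj V ψ) =
    (Fintype.card F : ℂ)⁻¹ * ∑ b, ψ b * V.character (g * unipotent b) := by
  rw [unipotentProj, mul_smul_comm, map_smul, Finset.mul_sum, map_sum, smul_eq_mul]
  congr 1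
  refine Finset.sum_congr rfl fun b _ => ?_
  rw [mul_smul_comm, ← map_mul, map_smul]
  rfl

theorem trace_unipotentProj : LinearMap.trace ℂ V (unipotentProj V ψ) =
    (Fintype.card F : ℂ)⁻¹ * ∑ b, ψ b * V.character (unipotent b) := by
  simpa using trace_mul_unipotentProj V ψ 1

theorem Irrep.exists_sum_unipotent_eq (x : Irrep (SL2 F)) (ψ : AddChar F ℂ) :
    ∃ n : ℕ, ∑ b, ψ b * x.character (unipotent b) = Fintype.card F * (n : ℂ) := by
  induction x using Quotient.inductionOn with | _ V =>
  refine ⟨Module.finrank ℂ (LinearMap.range (unipotentProj V.1 ψ)), ?_⟩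
  rw [← trace_of_isIdempotentElem (isIdempotentElem_unipotentProj V.1 ψ), trace_unipotentProj,
    mul_inv_cancel_left₀ card_cast_ne_zero]
  rfl

theorem rho_upper_mul_unipotentProj (a : Fˣ) :
    V.ρ (upper a 0) * unipotentProj V 1 = unipotentProj V 1 * V.ρ (upper a 0) := by
  rw [unipotentProj, mul_smul_comm, smul_mul_assoc, Finset.mul_sum, Finset.sum_mul]
  congr 1
  refine Fintype.sum_equiv ((a * a).mulLeft) _ _ fun b => ?_
  rw [mul_smul_comm, smul_mul_assoc, ← map_mul, ← map_mul, ← upper_one_eq_unipotent,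
    ← upper_one_eq_unipotent, upper_mul, upper_mul]
  have hconj : (a : F) * (b * (a : F)⁻¹) = b := by field_simp
  simp [mul_assoc, hconj]

-- The torus normalises the unipotent subgroup, so it acts on the line of fixed vectors.
theorem Irrep.exists_torus_character {x : Irrep (SL2 F)}
    (h : ∑ b : F, x.character (unipotent b) = Fintype.card F) :
    ∃ α : Fˣ →* ℂ, ∀ a, ∑ b, x.character (upper a b) = Fintype.card F * α a := by
  induction x using Quotient.inductionOn with | _ V =>
  have htrace : LinearMap.trace ℂ V.1 (unipotentProj V.1 1) = 1 := by
    rw [trace_unipotentProj]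
    simp only [AddChar.one_apply, one_mul]
    exact (inv_mul_eq_one₀ card_cast_ne_zero).2 h.symm
  have hscalar (a : Fˣ) : V.1.ρ (upper a 0) * unipotentProj V.1 1 =
      LinearMap.trace ℂ V.1 (V.1.ρ (upper a 0) * unipotentProj V.1 1) • unipotentProj V.1 1 :=
    mul_eq_smul_of_trace_eq_one (isIdempotentElem_unipotentProj V.1 1) htrace
      (rho_upper_mul_unipotentProj V.1 a)
  refine ⟨⟨⟨fun a => LinearMap.trace ℂ V.1 (V.1.ρ (upper a 0) * unipotentProj V.1 1), ?_⟩,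
    fun a b => ?_⟩, fun a => ?_⟩
  · rw [upper_one_zero, map_one, one_mul, htrace]
  · have hmul : upper (a * b) (0 : F) = upper a 0 * upper b 0 := by rw [upper_mul]; simp
    dsimp only
    rw [hmul, map_mul V.1.ρ, mul_assoc]
    conv_lhs => rw [hscalar b]
    rw [mul_smul_comm, map_smul, smul_eq_mul, mul_comm]
  · change _ = (Fintype.card F : ℂ) *
      LinearMap.trace ℂ V.1 (V.1.ρ (upper a 0) * unipotentProj V.1 1)
    rw [trace_mul_unipotentProj, mul_inv_cancel_left₀ card_cast_ne_zero]
    refine Fintype.sum_equiv (a⁻¹.mulLeft) _ _ fun b => ?_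
    rw [AddChar.one_apply, one_mul, ← upper_one_eq_unipotent, upper_mul]
    simp
    rfl

section TorusCharacter

variable {x : Irrep (SL2 F)} {α : Fˣ →* ℂ}

theorem Irrep.character_upper
    (h : ∀ a, ∑ b, x.character (upper a b) = Fintype.card F * α a) {a : Fˣ} (ha : a ≠ a⁻¹)
    (b : F) : x.character (upper a b) = α a := by
  have hconj (b : F) : x.character (upper a b) = x.character (upper a 0) :=
    x.character_eq_of_isConj (isConj_upper_diag ha b)
  have hsum := h a
  simp only [hconj, Finset.sum_const, Finset.card_univ, nsmul_eq_mul] at hsum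
  rw [hconj]
  exact mul_left_cancel₀ card_cast_ne_zero hsum

theorem Irrep.torus_character_mul_self
    (h : ∀ a, ∑ b, x.character (upper a b) = Fintype.card F * α a) (a : Fˣ) : α a * α a = 1 := by
  have hinv : α a = α a⁻¹ := by
    by_cases ha : a = a⁻¹
    · rw [← ha]
    · rw [← x.character_upper h ha 0, ← x.character_upper h (by rwa [inv_inv, ne_comm]) 0]
      exact x.character_eq_of_isConj (isConj_upper_diag_inv a)
  nth_rw 2 [hinv]
  rw [← map_mul, mul_inv_cancel, map_one]

theorem Irrep.torus_character_neg_one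
    (h : ∀ a, ∑ b, x.character (upper a b) = Fintype.card F * α a) :
    α (-1) = x.centralSign := by
  have hneg (b : F) : upper (-1) b = -unipotent (-b) := by simp [SL2.ext_iff_entries]
  have hone := h 1
  have hsum := h (-1)
  simp only [hneg, x.character_neg, ← Finset.mul_sum] at hsum
  simp only [upper_one_eq_unipotent, map_one, mul_one] at hone
  rw [Fintype.sum_equiv (Equiv.neg F) (fun b => x.character (unipotent (-b)))
    (fun b => x.character (unipotent b)) fun _ => rfl, hone, mul_comm] at hsum
  exact (mul_left_cancel₀ card_cast_ne_zero hsum).symm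

end TorusCharacter

theorem torus_character_cases (α : Fˣ →* ℂ) (h : ∀ a, α a * α a = 1) :
    (∀ a, α a = 1) ∨ ∀ a, α a = chi (a : F) := by
  refine or_iff_not_imp_left.2 fun hne => ?_
  push Not at hne
  obtain ⟨ν, hν⟩ := hne
  have hνα : α ν = -1 := (mul_self_eq_one_iff.1 (h ν)).resolve_left hν
  have hsq (a : Fˣ) (ha : chi (a : F) = 1) : α a = 1 := by
    obtain ⟨s, hs⟩ := isSquare_of_chi_eq_one ha
    have hs0 : s ≠ 0 := left_ne_zero_of_mul (hs ▸ a.ne_zero)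
    rw [show a = Units.mk0 s hs0 * Units.mk0 s hs0 from Units.ext hs, map_mul, h]
  have hνchi : chi (ν : F) = -1 := (chi_eq_one_or ν.ne_zero).resolve_left fun h => hν (hsq ν h)
  intro a
  rcases chi_eq_one_or a.ne_zero with ha | ha
  · rw [ha, hsq a ha]
  · have hmul := hsq (a * ν) (by rw [Units.val_mul, map_mul, ha, hνchi]; norm_num)
    rw [map_mul, hνα] at hmul
    rw [ha]
    linear_combination -hmul

end Unipotent

section Trivial

variable {F : Type*} [Field F] [Finite F]

theorem rho_eq_one_of_character_unipotent {V : FDRep ℂ (SL2 F)}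
    (h : ∀ b : F, V.character (unipotent b) = Module.finrank ℂ V) (g : SL2 F) : V.ρ g = 1 := by
  have := Fintype.ofFinite F
  have htrace : LinearMap.trace ℂ V (unipotentProj V 1) = Module.finrank ℂ V := by
    simp only [trace_unipotentProj, AddChar.one_apply, one_mul, h, Finset.sum_const,
      Finset.card_univ, nsmul_eq_mul]
    rw [inv_mul_cancel_left₀ card_cast_ne_zero]
  have hproj : unipotentProj V 1 = 1 := by
    refine (sub_eq_zero.1 (LinearMap.IsIdempotentElem.eq_zero_of_trace_eq_zero
      (isIdempotentElem_unipotentProj V 1).one_sub ?_)).symm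
    rw [map_sub, htrace, LinearMap.trace_one, sub_self]
  have hker : MonoidHom.ker V.ρ = ⊤ := eq_top_of_unipotent_mem _ fun b => by
    simpa [hproj, MonoidHom.mem_ker] using smul_rho_mul_unipotentProj V 1 b
  exact MonoidHom.mem_ker.1 (hker ▸ Subgroup.mem_top g)

theorem Irrep.eq_triv_of_character_unipotent {x : Irrep (SL2 F)}
    (h : ∀ b : F, x.character (unipotent b) = x.dim) : x = Irrep.triv (SL2 F) := by
  classical
  have := Fintype.ofFinite F
  have hconst (g : SL2 F) : x.character g = x.dim := by
    induction x using Quotient.inductionOn with | _ V =>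
    change LinearMap.trace ℂ V.1 (V.1.ρ g) = _
    rw [rho_eq_one_of_character_unipotent h g, LinearMap.trace_one]
    rfl
  by_contra hne
  have horth := x.sum_character_mul_star (Irrep.triv (SL2 F))
  rw [if_neg hne] at horth
  simp only [hconst, Irrep.character_triv, star_one, mul_one, Finset.sum_const, Finset.card_univ,
    nsmul_eq_mul] at horth
  exact x.dim_pos.ne' (Nat.cast_eq_zero.1
    ((mul_eq_zero.1 horth).resolve_left card_cast_ne_zero))

end Trivial

section Classes

variable {F : Type*} [Field F]

/-- `g` has two distinct eigenvalues in `F`. -/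
def IsSplit (g : SL2 F) : Prop := ∃ a : Fˣ, a ≠ a⁻¹ ∧ IsConj g (upper a 0)

/-- The characteristic polynomial `X² - (tr g) X + 1` of `g` is irreducible, expressed through its
discriminant; this is the right notion only when `2 ≠ 0` in `F`. -/
def IsElliptic (g : SL2 F) : Prop := ¬ IsSquare (g.1.trace ^ 2 - 4)

theorem two_ne_neg_two (h2 : (2 : F) ≠ 0) : (2 : F) ≠ -2 := fun h =>
  mul_ne_zero h2 h2 (by linear_combination h)

theorem ne_neg_one_of_trace_eq_two (h2 : (2 : F) ≠ 0) {g : SL2 F} (ht : g.1.trace = 2) :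
    g ≠ -1 := by
  rintro rfl
  rw [trace_neg, trace_one] at ht
  exact two_ne_neg_two h2 ht.symm

theorem ne_one_of_trace_ne_two {g : SL2 F} (ht : g.1.trace ≠ 2) : g ≠ 1 := fun h =>
  ht (h ▸ trace_one)

theorem trace_upper_sub_two (a : Fˣ) : (upper a (0 : F)).1.trace - 2 = (a - 1) ^ 2 / a := by
  rw [trace_upper]
  push_cast
  field_simp
  ring

theorem trace_upper_add_two (a : Fˣ) : (upper a (0 : F)).1.trace + 2 = (a + 1) ^ 2 / a := by
  rw [trace_upper]
  push_cast
  field_simp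
  ring

theorem coe_ne_one_of_ne_inv {a : Fˣ} (ha : a ≠ a⁻¹) : (a : F) - 1 ≠ 0 := fun h => by
  rw [sub_eq_zero, Units.val_eq_one] at h
  simp [h] at ha

theorem coe_ne_neg_one_of_ne_inv {a : Fˣ} (ha : a ≠ a⁻¹) : (a : F) + 1 ≠ 0 := fun h => by
  have : a = -1 := Units.ext (by simpa using eq_neg_of_add_eq_zero_left h)
  simp [this] at ha

theorem IsSplit.trace_ne_two {g : SL2 F} (hg : IsSplit g) : g.1.trace ≠ 2 := by
  obtain ⟨a, ha, hc⟩ := hg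
  rw [trace_eq_of_isConj hc, ← sub_ne_zero, trace_upper_sub_two]
  exact div_ne_zero (pow_ne_zero 2 (coe_ne_one_of_ne_inv ha)) a.ne_zero

theorem IsSplit.neg {g : SL2 F} (hg : IsSplit g) : IsSplit (-g) := by
  obtain ⟨a, ha, hc⟩ := hg
  refine ⟨-a, by simpa using ha, ?_⟩
  have : upper (-a) (0 : F) = -upper a 0 := by simp [SL2.ext_iff_entries]
  rwa [this, isConj_neg_iff]

theorem IsElliptic.neg {g : SL2 F} (hg : IsElliptic g) : IsElliptic (-g) := by
  rwa [IsElliptic, trace_neg, neg_sq]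

theorem IsElliptic.trace_ne_two {g : SL2 F} (hg : IsElliptic g) : g.1.trace ≠ 2 := fun h =>
  hg ⟨0, by rw [h]; norm_num⟩

theorem IsSplit.ne_one {g : SL2 F} (hg : IsSplit g) : g ≠ 1 :=
  ne_one_of_trace_ne_two hg.trace_ne_two

theorem IsSplit.ne_neg_one {g : SL2 F} (hg : IsSplit g) : g ≠ -1 := fun h =>
  hg.neg.ne_one (neg_eq_iff_eq_neg.2 h)

theorem IsElliptic.ne_one {g : SL2 F} (hg : IsElliptic g) : g ≠ 1 :=
  ne_one_of_trace_ne_two hg.trace_ne_two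

theorem IsElliptic.ne_neg_one {g : SL2 F} (hg : IsElliptic g) : g ≠ -1 := fun h =>
  hg.neg.ne_one (neg_eq_iff_eq_neg.2 h)

theorem isSplit_of_isSquare (h2 : (2 : F) ≠ 0) {g : SL2 F} (hs : IsSquare (g.1.trace ^ 2 - 4))
    (ht : g.1.trace ≠ 2) (ht' : (-g).1.trace ≠ 2) : IsSplit g := by
  obtain ⟨s, hs⟩ := hs
  have hprod : (g.1.trace + s) / 2 * ((g.1.trace - s) / 2) = 1 := by
    field_simp
    linear_combination hs
  obtain ⟨a, b, hc⟩ := exists_isConj_upper (g := g) ⟨Units.mkOfMulEqOne _ _ hprod, by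
    rw [show ((Units.mkOfMulEqOne _ _ hprod)⁻¹ : Fˣ) = (g.1.trace - s) / 2 from rfl,
      Units.val_mkOfMulEqOne]
    field_simp
    ring⟩
  have ha : a ≠ a⁻¹ := by
    intro h
    have hsq : (a : F) * a = 1 := by simpa using congrArg Units.val (mul_eq_one_iff_eq_inv.2 h)
    have htr := trace_eq_of_isConj hc
    rw [trace_upper, ← h] at htr
    rcases mul_self_eq_one_iff.1 hsq with h | h
    · exact ht (by rw [htr, h]; norm_num)
    · exact ht' (by rw [trace_neg, htr, h]; norm_num)
  exact ⟨a, ha, hc.trans (isConj_upper_diag ha b)⟩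

theorem SL2.trace_cases (h2 : (2 : F) ≠ 0) (g : SL2 F) :
    g.1.trace = 2 ∨ (-g).1.trace = 2 ∨ IsSplit g ∨ IsElliptic g := by
  by_cases ht : g.1.trace = 2
  · exact .inl ht
  by_cases ht' : (-g).1.trace = 2
  · exact .inr (.inl ht')
  by_cases hs : IsSquare (g.1.trace ^ 2 - 4)
  · exact .inr (.inr (.inl (isSplit_of_isSquare h2 hs ht ht')))
  · exact .inr (.inr (.inr hs))

end Classes

section ClassCharacter

variable {F : Type*} [Field F] [Fintype F]

theorem chi_trace_sub_two_of_isConj_upper {g : SL2 F} {a : Fˣ} (ha : a ≠ a⁻¹)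
    (hc : IsConj g (upper a 0)) : chi (g.1.trace - 2) = chi (a : F) := by
  rw [trace_eq_of_isConj hc, trace_upper_sub_two, chi_div, chi_sq (coe_ne_one_of_ne_inv ha),
    one_mul]

theorem chi_trace_add_two_of_isConj_upper {g : SL2 F} {a : Fˣ} (ha : a ≠ a⁻¹)
    (hc : IsConj g (upper a 0)) : chi (g.1.trace + 2) = chi (a : F) := by
  rw [trace_eq_of_isConj hc, trace_upper_add_two, chi_div, chi_sq (coe_ne_neg_one_of_ne_inv ha),
    one_mul]

theorem IsElliptic.chi_trace_add_two {g : SL2 F} (hg : IsElliptic g) :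
    chi (g.1.trace + 2) = -chi (g.1.trace - 2) := by
  have hsub : chi (g.1.trace - 2) * chi (g.1.trace - 2) = 1 :=
    chi_mul_self (sub_ne_zero.2 hg.trace_ne_two)
  have hprod : chi (g.1.trace + 2) * chi (g.1.trace - 2) = -1 := by
    rw [← map_mul, ← chi_eq_neg_one hg]
    congr 1
    ring
  linear_combination chi (g.1.trace - 2) * hprod - chi (g.1.trace + 2) * hsub

theorem isConj_unipotent_of_chi_div {b c : F} (hb : b ≠ 0) (hc : c ≠ 0) (h : chi (b / c) = 1) :
    IsConj (unipotent b) (unipotent c) := by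
  obtain ⟨s, hs⟩ := isSquare_of_chi_eq_one h
  have hs0 : s ≠ 0 := left_ne_zero_of_mul (hs ▸ div_ne_zero hb hc)
  have hconj := isConj_unipotent_mul_sq (Units.mk0 s hs0) c
  rw [Units.val_mk0, sq, ← hs, div_mul_cancel₀ _ hc] at hconj
  exact hconj.symm

end ClassCharacter

section UnipotentClass

variable {F : Type*} [Field F] [Finite F]

theorem isConj_unipotent_cases {ε : F} (hε : ¬ IsSquare ε) {b : F} (hb : b ≠ 0) :
    IsConj (unipotent b) (unipotent 1) ∨ IsConj (unipotent b) (unipotent ε) := by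
  have := Fintype.ofFinite F
  rcases chi_eq_one_or hb with h | h
  · exact .inl (isConj_unipotent_of_chi_div hb one_ne_zero (by rwa [div_one]))
  · exact .inr (isConj_unipotent_of_chi_div hb (ne_zero_of_not_isSquare hε)
      (by rw [chi_div, h, chi_eq_neg_one hε, neg_mul_neg, one_mul]))

theorem isConj_unipotent_iff_trace_eq_two {ε : F} (hε : ¬ IsSquare ε) {g : SL2 F} (h1 : g ≠ 1) :
    IsConj g (unipotent 1) ∨ IsConj g (unipotent ε) ↔ g.1.trace = 2 := by
  refine ⟨?_, fun ht => ?_⟩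
  · rintro (hc | hc) <;> rw [trace_eq_of_isConj hc, trace_unipotent]
  obtain ⟨b, hb, hc⟩ := exists_isConj_unipotent ht h1
  exact (isConj_unipotent_cases hε hb).imp hc.trans hc.trans

end UnipotentClass

section ClassCount

variable {F : Type*} [Field F]

/-- Representatives of the classes of trace two, when `ε` is a non-square. -/
def unipotentRep (ε : F) : Fin 3 → SL2 F := ![1, unipotent 1, unipotent ε]

theorem trace_unipotentRep (ε : F) (i : Fin 3) : (unipotentRep ε i).1.trace = 2 := by
  fin_cases i
  exacts [trace_one, trace_unipotent 1, trace_unipotent ε]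

theorem unipotentRep_isConj_imp_eq {ε : F} (hε : ¬ IsSquare ε) {i j : Fin 3}
    (h : IsConj (unipotentRep ε i) (unipotentRep ε j)) : i = j := by
  have hone {b : F} (hb : b ≠ 0) : ¬ IsConj (1 : SL2 F) (unipotent b) := fun h =>
    unipotent_ne_one hb (isConj_one_right.1 h)
  have h01 := hone one_ne_zero
  have h02 := hone (ne_zero_of_not_isSquare hε)
  have h12 := not_isConj_unipotent hε
  fin_cases i <;> fin_cases j <;>
    first
    | rfl
    | exact absurd h ‹_›
    | exact absurd h.symm ‹_›

/-- Representatives of conjugacy classes: the companion matrices of trace `t ≠ ±2`, and `±u` for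
`u` of trace two. -/
def classRep (ε : F) : {t : F // t ≠ 2 ∧ t ≠ -2} ⊕ (Fin 3 ⊕ Fin 3) → SL2 F :=
  Sum.elim (fun t => SL2.mk 0 (-1) 1 t.1 (by simp))
    (Sum.elim (unipotentRep ε) fun i => -unipotentRep ε i)

theorem trace_classRep (ε : F) (i : {t : F // t ≠ 2 ∧ t ≠ -2} ⊕ (Fin 3 ⊕ Fin 3)) :
    (classRep ε i).1.trace = Sum.elim Subtype.val (Sum.elim (fun _ => 2) fun _ => -2) i := by
  rcases i with t | i | i
  · exact (Matrix.trace_fin_two _).trans (zero_add _)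
  · exact trace_unipotentRep ε i
  · exact (trace_neg _).trans (congrArg _ (trace_unipotentRep ε i))

theorem classRep_isConj_imp_eq (h2 : (2 : F) ≠ 0) {ε : F} (hε : ¬ IsSquare ε)
    {i j : {t : F // t ≠ 2 ∧ t ≠ -2} ⊕ (Fin 3 ⊕ Fin 3)}
    (h : IsConj (classRep ε i) (classRep ε j)) : i = j := by
  have ht := trace_eq_of_isConj h
  rw [trace_classRep, trace_classRep] at ht
  rcases i with t | i | i <;> rcases j with s | j | j <;>
    simp only [Sum.elim_inl, Sum.elim_inr] at ht
  · rw [Subtype.ext ht]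
  · exact absurd ht t.2.1
  · exact absurd ht t.2.2
  · exact absurd ht.symm s.2.1
  · rw [unipotentRep_isConj_imp_eq hε h]
  · exact absurd ht (two_ne_neg_two h2)
  · exact absurd ht.symm s.2.2
  · exact absurd ht.symm (two_ne_neg_two h2)
  · rw [unipotentRep_isConj_imp_eq hε (isConj_neg_iff.1 h)]

theorem card_add_four_le_card_irrep [Fintype F] (h2 : (2 : F) ≠ 0) {ε : F} (hε : ¬ IsSquare ε) :
    Fintype.card F + 4 ≤ Fintype.card (Irrep (SL2 F)) := by
  classical
  have hcard := card_le_card_irrep (classRep ε) fun _ _ => classRep_isConj_imp_eq h2 hε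
  have hsubtype : Fintype.card {t : F // t ≠ 2 ∧ t ≠ -2} = Fintype.card F - 2 := by
    rw [← Finset.card_pair (two_ne_neg_two h2), ← Fintype.card_coe, ← Fintype.card_subtype_compl]
    exact Fintype.card_congr (Equiv.subtypeEquivRight fun t => by simp)
  have hle := Finset.card_le_univ ({2, -2} : Finset F)
  rw [Finset.card_pair (two_ne_neg_two h2)] at hle
  rw [Fintype.card_sum, Fintype.card_sum, Fintype.card_fin] at hcard
  omega

end ClassCount

theorem two_ne_zero_of_not_isSquare {F : Type*} [Field F] [Finite F] {ε : F}
    (hε : ¬ IsSquare ε) : (2 : F) ≠ 0 :=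
  Ring.two_ne_zero fun h => hε (FiniteField.isSquare_of_char_two h ε)

theorem exists_addChar_ne_one (F : Type*) [Field F] [Finite F] : ∃ ψ : AddChar F ℂ, ψ ≠ 1 := by
  obtain ⟨ψ, hψ⟩ := AddChar.exists_apply_ne_zero (a := (1 : F)) |>.2 one_ne_zero
  exact ⟨ψ, fun h => hψ (by rw [h, AddChar.one_apply])⟩

theorem mulShift_ne_one_of_not_isSquare {F : Type*} [Field F] {ε : F} (hε : ¬ IsSquare ε)
    {ψ : AddChar F ℂ} (hψ : ψ ≠ 1) : ψ.mulShift ε ≠ 1 :=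
  AddChar.IsPrimitive.of_ne_one hψ (ne_zero_of_not_isSquare hε)

section WeilSum

variable {F : Type*} [Field F] [Fintype F]

theorem parityPart_neg (σ : ℤˣ) (φ : SL2 F → ℂ) (g : SL2 F) :
    parityPart σ φ (-g) = σ * (chi (-1 : F) * parityPart σ φ g) := by
  have hσ : (σ : ℂ) * σ = 1 := by exact_mod_cast Int.units_coe_mul_self σ
  rw [parityPart, parityPart, neg_neg]
  linear_combination -(φ (-g) / 2) * (chi (-1 : F) * chi (-1 : F)) * hσ -
    φ (-g) / 2 * chi_neg_one_mul_self (F := F)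

open scoped Classical in
/-- The sum of the characters of the two Weil representations, which belong to an additive character
`ψ` and to its twist `ψ (ε ·)` by a non-square `ε`. At unipotent `g ≠ 1` their values cancel, in
accordance with `chi 0 = 0`. -/
def weilPairCharacter (g : SL2 F) : ℂ :=
  if g = 1 then 2 * Fintype.card F else 2 * chi (g.1.trace - 2)

/-- The sum of the characters of the even (`σ = 1`) or odd (`σ = -1`) constituents of the two Weil
representations. -/
def weilSum (σ : ℤˣ) (g : SL2 F) : ℂ := parityPart σ weilPairCharacter g

theorem weilPairCharacter_of_ne_one {g : SL2 F} (h1 : g ≠ 1) :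
    weilPairCharacter g = 2 * chi (g.1.trace - 2) := if_neg h1

theorem chi_neg_one_mul_weilPairCharacter_neg {g : SL2 F} (h1 : g ≠ -1) :
    chi (-1 : F) * weilPairCharacter (-g) = 2 * chi (g.1.trace + 2) := by
  rw [weilPairCharacter_of_ne_one (mt neg_eq_iff_eq_neg.1 h1), mul_left_comm, ← map_mul, trace_neg]
  congr 2
  ring

theorem chi_trace_add_two_of_trace_eq_two (h2 : (2 : F) ≠ 0) {g : SL2 F} (ht : g.1.trace = 2) :
    chi (g.1.trace + 2) = 1 := by
  rw [ht, show (2 : F) + 2 = 2 ^ 2 by norm_num, chi_sq h2]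

variable (σ : ℤˣ)

theorem weilSum_neg (g : SL2 F) : weilSum σ (-g) = σ * (chi (-1 : F) * weilSum σ g) :=
  parityPart_neg _ _ _

theorem weilSum_one (h2 : (2 : F) ≠ 0) : weilSum σ (1 : SL2 F) = Fintype.card F + σ := by
  rw [weilSum, parityPart,
    chi_neg_one_mul_weilPairCharacter_neg (ne_neg_one_of_trace_eq_two h2 trace_one),
    chi_trace_add_two_of_trace_eq_two h2 trace_one, weilPairCharacter, if_pos rfl]
  ring

theorem weilSum_of_ne {g : SL2 F} (h1 : g ≠ 1) (h1' : g ≠ -1) :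
    weilSum σ g = chi (g.1.trace - 2) + σ * chi (g.1.trace + 2) := by
  rw [weilSum, parityPart, chi_neg_one_mul_weilPairCharacter_neg h1',
    weilPairCharacter_of_ne_one h1]
  ring

theorem weilSum_of_trace_eq_two (h2 : (2 : F) ≠ 0) {g : SL2 F} (ht : g.1.trace = 2)
    (h1 : g ≠ 1) : weilSum σ g = σ := by
  rw [weilSum_of_ne σ h1 (ne_neg_one_of_trace_eq_two h2 ht),
    chi_trace_add_two_of_trace_eq_two h2 ht, ht, sub_self, chi_zero, zero_add, mul_one]

theorem weilSum_of_isConj_upper {g : SL2 F} {a : Fˣ} (ha : a ≠ a⁻¹) (hc : IsConj g (upper a 0)) :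
    weilSum σ g = (1 + σ) * chi (a : F) := by
  have hg : IsSplit g := ⟨a, ha, hc⟩
  rw [weilSum_of_ne σ hg.ne_one hg.ne_neg_one,
    chi_trace_sub_two_of_isConj_upper ha hc, chi_trace_add_two_of_isConj_upper ha hc]
  ring

theorem IsElliptic.weilSum {g : SL2 F} (hg : IsElliptic g) :
    weilSum σ g = (1 - σ) * chi (g.1.trace - 2) := by
  rw [weilSum_of_ne σ hg.ne_one hg.ne_neg_one, hg.chi_trace_add_two]
  ring

end WeilSum

section WeilIrreps

variable {F : Type*} [Field F] [Fintype F] {ε : F}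

theorem sum_intUnits (f : ℤˣ → ℂ) : ∑ τ, f τ = f 1 + f (-1) := by
  rw [UnitsInt.univ, Finset.sum_pair (by decide)]

/-- The four irreducible constituents of the two Weil representations, as `irrep σ τ` with `σ` the
parity and `τ` telling the two representations apart. Their values at the two classes of unipotent
elements involve the Gauss sum `γ`. -/
structure WeilIrreps (ε : F) where
  not_isSquare : ¬ IsSquare ε
  irrep : ℤˣ → ℤˣ → Irrep (SL2 F)
  γ : ℂ
  gamma_mul_star : γ * star γ = Fintype.card F
  dim_irrep (σ τ : ℤˣ) : ((irrep σ τ).dim : ℂ) = (Fintype.card F + σ) / 2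
  character_unipotent_one (σ τ : ℤˣ) : (irrep σ τ).character (unipotent 1) = (σ + τ * γ) / 2
  character_unipotent_nonsquare (σ τ : ℤˣ) :
    (irrep σ τ).character (unipotent ε) = (σ - τ * γ) / 2
  sum_character (σ : ℤˣ) (g : SL2 F) : ∑ τ, (irrep σ τ).character g = weilSum σ g

variable {ψ : AddChar F ℂ}

theorem gaussSum_chi_mulShift (hε : ¬ IsSquare ε) :
    gaussSum chi (ψ.mulShift ε) = -gaussSum chi ψ := by
  have h := gaussSum_mulShift chi ψ (Units.mk0 ε (ne_zero_of_not_isSquare hε))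
  rw [Units.val_mk0, chi_eq_neg_one hε] at h
  linear_combination -h

theorem weilCharacter_add_weilCharacter_mulShift (hε : ¬ IsSquare ε) (hψ : ψ ≠ 1) (g : SL2 F) :
    weilCharacter ψ g + weilCharacter (ψ.mulShift ε) g = weilPairCharacter g := by
  have h2 := two_ne_zero_of_not_isSquare hε
  have hψ' := mulShift_ne_one_of_not_isSquare hε hψ
  by_cases h1 : g = 1
  · rw [h1, weilPairCharacter, if_pos rfl, weilCharacter_one, weilCharacter_one, two_mul]
  rw [weilPairCharacter_of_ne_one h1]
  by_cases ht : g.1.trace = 2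
  · obtain ⟨b, hb, hc⟩ := exists_isConj_unipotent ht h1
    rw [ht, sub_self, chi_zero, weilCharacter_eq_of_isConj h2 hψ hc,
      weilCharacter_eq_of_isConj h2 hψ' hc, weilCharacter_unipotent h2 hψ hb,
      weilCharacter_unipotent h2 hψ' hb,
      gaussSum_chi_mulShift hε]
    ring
  · rw [weilCharacter_of_trace_ne_two h2 hψ ht, weilCharacter_of_trace_ne_two h2 hψ' ht, two_mul]

theorem nonempty_weilIrreps (hε : ¬ IsSquare ε) : Nonempty (WeilIrreps ε) := by
  have h2 := two_ne_zero_of_not_isSquare hε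
  have hε0 := ne_zero_of_not_isSquare hε
  obtain ⟨ψ, hψ⟩ := exists_addChar_ne_one F
  let Ψ (τ : ℤˣ) : AddChar F ℂ := if τ = 1 then ψ else ψ.mulShift ε
  have hΨ (τ : ℤˣ) : Ψ τ ≠ 1 := by
    rcases Int.units_eq_one_or τ with rfl | rfl
    exacts [hψ, mulShift_ne_one_of_not_isSquare hε hψ]
  have hgauss (τ : ℤˣ) : gaussSum chi (Ψ τ) = τ * gaussSum chi ψ := by
    rcases Int.units_eq_one_or τ with rfl | rfl
    · simp [Ψ]
    · simpa [Ψ] using gaussSum_chi_mulShift hε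
  choose X hX using fun σ τ => exists_character_eq_parityPart h2 (hΨ τ) σ
  refine ⟨⟨hε, X, chi (2 : F) * gaussSum chi ψ, ?_, fun σ τ => ?_, fun σ τ => ?_, fun σ τ => ?_,
    fun σ g => ?_⟩⟩
  · rw [star_mul', star_chi, mul_mul_mul_comm, chi_mul_self h2, one_mul,
      gaussSum_chi_mul_star h2 hψ]
  · rw [← Irrep.character_one, hX, parityPart_weilCharacter_one h2 (hΨ τ)]
  · rw [hX, parityPart_weilCharacter_unipotent h2 (hΨ τ) σ one_ne_zero, hgauss, map_one]
    ring
  · rw [hX, parityPart_weilCharacter_unipotent h2 (hΨ τ) σ hε0, hgauss, chi_eq_neg_one hε]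
    ring
  · rw [sum_intUnits, hX, hX, weilSum]
    simp only [parityPart, ← weilCharacter_add_weilCharacter_mulShift hε hψ]
    simp only [Ψ, if_pos, show (-1 : ℤˣ) ≠ 1 by decide, if_neg, not_false_eq_true]
    ring

namespace WeilIrreps

variable (D : WeilIrreps ε)

include D in
theorem two_ne_zero : (2 : F) ≠ 0 := two_ne_zero_of_not_isSquare D.not_isSquare

theorem gamma_ne_zero : D.γ ≠ 0 := fun h => by
  have hγ := D.gamma_mul_star
  rw [h, zero_mul] at hγ
  exact card_cast_ne_zero hγ.symm

theorem irrep_injective : Function.Injective fun p : ℤˣ × ℤˣ => D.irrep p.1 p.2 := by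
  rintro ⟨σ, τ⟩ ⟨σ', τ'⟩ (h : D.irrep σ τ = D.irrep σ' τ')
  have hσ : (σ : ℂ) = σ' := by
    have hdim := D.dim_irrep σ τ
    rw [h, D.dim_irrep] at hdim
    linear_combination -2 * hdim
  have hτ : (τ : ℂ) = τ' := by
    have hone := D.character_unipotent_one σ τ
    rw [h, D.character_unipotent_one] at hone
    exact mul_right_cancel₀ D.gamma_ne_zero (by linear_combination -2 * hone - hσ)
  exact Prod.ext (by exact_mod_cast hσ) (by exact_mod_cast hτ)

theorem character_unipotent_one_ne (σ τ : ℤˣ) :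
    (D.irrep σ τ).character (unipotent 1) ≠ (D.irrep σ τ).character (unipotent ε) := by
  rw [D.character_unipotent_one, D.character_unipotent_nonsquare]
  intro h
  have hτ : (τ : ℂ) * D.γ = 0 := by linear_combination h
  rcases Int.units_eq_one_or τ with rfl | rfl <;> simp [D.gamma_ne_zero] at hτ

theorem irrep_ne_triv (σ τ : ℤˣ) : D.irrep σ τ ≠ Irrep.triv (SL2 F) := fun h =>
  D.character_unipotent_one_ne σ τ (by rw [h, Irrep.character_triv, Irrep.character_triv])

open scoped Classical in
/-- The constituents of the Weil representations. -/
def gens : Finset (Irrep (SL2 F)) := Finset.univ.image fun p : ℤˣ × ℤˣ => D.irrep p.1 p.2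

open scoped Classical in
/-- The irreps other than the trivial one and the constituents of the Weil representations. -/
def others : Finset (Irrep (SL2 F)) := Finset.univ \ insert (Irrep.triv (SL2 F)) D.gens

theorem mem_gens {x : Irrep (SL2 F)} : x ∈ D.gens ↔ ∃ σ τ, D.irrep σ τ = x := by
  simp [gens]

theorem triv_notMem_gens : Irrep.triv (SL2 F) ∉ D.gens := by simp [mem_gens, irrep_ne_triv]

theorem mem_others {x : Irrep (SL2 F)} :
    x ∈ D.others ↔ x ≠ Irrep.triv (SL2 F) ∧ x ∉ D.gens := by
  simp [others]

theorem sum_gens (f : Irrep (SL2 F) → ℂ) : ∑ x ∈ D.gens, f x = ∑ σ, ∑ τ, f (D.irrep σ τ) := by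
  classical
  rw [gens, Finset.sum_image D.irrep_injective.injOn, Fintype.sum_prod_type]

theorem sum_eq (f : Irrep (SL2 F) → ℂ) : ∑ x, f x =
    f (Irrep.triv (SL2 F)) + ∑ σ, ∑ τ, f (D.irrep σ τ) + ∑ x ∈ D.others, f x := by
  classical
  rw [← D.sum_gens, ← Finset.sum_insert D.triv_notMem_gens, add_comm, others]
  convert (Finset.sum_sdiff (Finset.subset_univ _)).symm

theorem card_le_card_others_add_one : Fintype.card F ≤ D.others.card + 1 := by
  have hsum := D.sum_eq fun _ => 1
  simp only [Finset.sum_const, Finset.card_univ, Fintype.card_units_int, nsmul_eq_mul,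
    mul_one] at hsum
  have hcard : Fintype.card (Irrep (SL2 F)) = D.others.card + 5 := by
    exact_mod_cast (by rw [hsum]; push_cast; ring :
      (Fintype.card (Irrep (SL2 F)) : ℂ) = (D.others.card + 5 : ℕ))
  have := card_add_four_le_card_irrep D.two_ne_zero D.not_isSquare
  omega

end WeilIrreps

end WeilIrreps

section Counting

open scoped ComplexOrder in
theorem eq_zero_of_sum_mul_star_eq_zero {ι : Type*} {s : Finset ι} {z : ι → ℂ}
    (h : ∑ i ∈ s, z i * star (z i) = 0) {i : ι} (hi : i ∈ s) : z i = 0 :=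
  CStarRing.mul_star_self_eq_zero_iff (z i) |>.1
    ((Finset.sum_eq_zero_iff_of_nonneg fun _ _ => mul_star_self_nonneg _).1 h i hi)

theorem eq_one_of_sum_mul_self_le_card {ι : Type*} {s : Finset ι} {m : ι → ℕ}
    (hm : ∀ i ∈ s, 0 < m i) (h : ∑ i ∈ s, m i * m i ≤ s.card) {i : ι} (hi : i ∈ s) :
    m i = 1 := by
  have hle : ∀ j ∈ s, 1 ≤ m j * m j := fun j hj => Nat.mul_pos (hm j hj) (hm j hj)
  have heq : ∑ j ∈ s, 1 = ∑ j ∈ s, m j * m j :=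
    (Finset.sum_le_sum hle).antisymm (by rwa [← Finset.card_eq_sum_ones])
  exact Nat.eq_one_of_mul_eq_one_right ((Finset.sum_eq_sum_iff_of_le hle).1 heq i hi).symm

theorem sum_dim_mul_character_of_ne_one {G : Type*} [Group G] [Finite G] {g : G} (hg : g ≠ 1) :
    ∑ x : Irrep G, (x.dim : ℂ) * x.character g = 0 := by
  have := Fintype.ofFinite G
  rw [sum_dim_mul_character, if_neg hg]

variable {F : Type*} [Field F] [Fintype F]

/-- The dimension of the space of vectors fixed by the upper unipotent matrices. -/
def Irrep.fixedDim (x : Irrep (SL2 F)) : ℕ := (x.exists_sum_unipotent_eq 1).choose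

theorem Irrep.sum_character_unipotent (x : Irrep (SL2 F)) :
    ∑ b, x.character (unipotent b) = Fintype.card F * x.fixedDim := by
  rw [Irrep.fixedDim, ← (x.exists_sum_unipotent_eq 1).choose_spec]
  simp only [AddChar.one_apply, one_mul]

theorem card_SL2_cast : (Fintype.card (SL2 F) : ℂ) =
    Fintype.card F * ((Fintype.card F : ℂ) ^ 2 - 1) := by
  exact_mod_cast congrArg (Int.cast (R := ℂ)) (card_SL2 (F := F))

theorem sum_character_unipotent_mul_star (h2 : (2 : F) ≠ 0) {b : F} (hb : b ≠ 0) :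
    ∑ x : Irrep (SL2 F), x.character (unipotent b) * star (x.character (unipotent b)) =
      2 * Fintype.card F := by
  classical
  rw [sum_irrep_character_mul_star]
  convert congrArg (Nat.cast (R := ℂ)) (card_centralizer_unipotent h2 hb)
  exact_mod_cast rfl

theorem sum_dim_sub_character_unipotent_mul_star (h2 : (2 : F) ≠ 0) :
    ∑ x : Irrep (SL2 F), ((x.dim : ℂ) - x.character (unipotent 1)) *
      star ((x.dim : ℂ) - x.character (unipotent 1)) =
      Fintype.card F * ((Fintype.card F : ℂ) ^ 2 - 1) + 2 * Fintype.card F := by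
  have hcross := sum_dim_mul_character_of_ne_one (unipotent_ne_one (one_ne_zero (α := F)))
  have hcross' := congrArg star hcross
  simp only [star_sum, star_mul', star_natCast, star_zero] at hcross'
  simp only [star_sub, star_natCast, mul_sub, sub_mul, Finset.sum_sub_distrib, sum_dim_sq,
    card_SL2_cast, sum_character_unipotent_mul_star h2 one_ne_zero, hcross']
  rw [Finset.sum_congr rfl fun x _ => mul_comm (x.character (unipotent 1)) (x.dim : ℂ), hcross]
  ring

namespace WeilIrreps

variable {ε : F} (D : WeilIrreps ε)

-- The four constituents account for all of `∑ x, |x.character u₁ - x.character u_ε|² = 4 q`.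
theorem character_unipotent_one_eq {x : Irrep (SL2 F)} (hx : x ∈ D.others) :
    x.character (unipotent 1) = x.character (unipotent ε) := by
  have hnc := not_isConj_unipotent D.not_isSquare
  have h : ∑ x : Irrep (SL2 F), (x.character (unipotent 1) - x.character (unipotent ε)) *
      star (x.character (unipotent 1) - x.character (unipotent ε)) = 4 * Fintype.card F := by
    simp only [star_sub, mul_sub, sub_mul, Finset.sum_sub_distrib]
    rw [sum_character_unipotent_mul_star D.two_ne_zero one_ne_zero,
      sum_character_unipotent_mul_star D.two_ne_zero (ne_zero_of_not_isSquare D.not_isSquare),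
      sum_irrep_character_mul_star_of_not_isConj hnc,
      sum_irrep_character_mul_star_of_not_isConj fun h => hnc h.symm]
    ring
  have hsub (σ τ : ℤˣ) : (D.irrep σ τ).character (unipotent 1) -
      (D.irrep σ τ).character (unipotent ε) = τ * D.γ := by
    rw [D.character_unipotent_one, D.character_unipotent_nonsquare]
    ring
  rw [D.sum_eq] at h
  simp only [Irrep.character_triv, hsub, sum_intUnits, Units.val_one, Units.val_neg, Int.cast_one,
    Int.cast_neg, one_mul, neg_mul, star_neg, mul_neg, neg_neg, D.gamma_mul_star, sub_self,
    zero_mul] at h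
  exact sub_eq_zero.1 (eq_zero_of_sum_mul_star_eq_zero
    (z := fun x : Irrep (SL2 F) => x.character (unipotent 1) - x.character (unipotent ε))
    (by linear_combination h) hx)

theorem character_unipotent_eq {x : Irrep (SL2 F)} (hx : x ∈ D.others) {b : F} (hb : b ≠ 0) :
    x.character (unipotent b) = x.character (unipotent 1) := by
  rcases isConj_unipotent_cases D.not_isSquare hb with hc | hc
  · exact x.character_eq_of_isConj hc
  · rw [x.character_eq_of_isConj hc, D.character_unipotent_one_eq hx]

theorem sum_addChar_mul_character_unipotent {x : Irrep (SL2 F)} (hx : x ∈ D.others)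
    (ψ : AddChar F ℂ) : ∑ b, ψ b * x.character (unipotent b) =
      x.dim - x.character (unipotent 1) + (∑ b, ψ b) * x.character (unipotent 1) := by
  classical
  have hb (b : F) : ψ b * x.character (unipotent b) = ψ b * x.character (unipotent 1) +
      if b = 0 then x.dim - x.character (unipotent 1) else 0 := by
    split_ifs with h0
    · rw [h0, unipotent_zero, x.character_one, AddChar.map_zero_eq_one]
      ring
    · rw [D.character_unipotent_eq hx h0, add_zero]
  rw [Finset.sum_congr rfl fun b _ => hb b, Finset.sum_add_distrib, ← Finset.sum_mul,
    Finset.sum_ite_eq' Finset.univ (0 : F), if_pos (Finset.mem_univ _), add_comm]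

theorem exists_dim_sub_character_unipotent {x : Irrep (SL2 F)} (hx : x ∈ D.others) :
    ∃ m : ℕ, 0 < m ∧ (x.dim : ℂ) - x.character (unipotent 1) = Fintype.card F * m := by
  obtain ⟨ψ, hψ⟩ := exists_addChar_ne_one F
  obtain ⟨m, hm⟩ := x.exists_sum_unipotent_eq ψ
  rw [D.sum_addChar_mul_character_unipotent hx, AddChar.sum_eq_zero_of_ne_one hψ, zero_mul,
    add_zero] at hm
  refine ⟨m, Nat.pos_of_ne_zero ?_, hm⟩
  rintro rfl
  rw [Nat.cast_zero, mul_zero, sub_eq_zero] at hm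
  refine (D.mem_others.1 hx).1 (Irrep.eq_triv_of_character_unipotent fun b => ?_)
  rcases eq_or_ne b 0 with rfl | hb
  · rw [unipotent_zero, x.character_one]
  · rw [D.character_unipotent_eq hx hb, hm]

theorem sum_others_dim_sub_character_unipotent_mul_star :
    ∑ x ∈ D.others, ((x.dim : ℂ) - x.character (unipotent 1)) *
      star ((x.dim : ℂ) - x.character (unipotent 1)) =
      (Fintype.card F : ℂ) ^ 2 * (Fintype.card F - 1) := by
  have hsum := sum_dim_sub_character_unipotent_mul_star D.two_ne_zero
  have hsub (σ τ : ℤˣ) : ((D.irrep σ τ).dim : ℂ) - (D.irrep σ τ).character (unipotent 1) =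
      (Fintype.card F - τ * D.γ) / 2 := by
    rw [D.dim_irrep, D.character_unipotent_one]
    ring
  rw [D.sum_eq] at hsum
  simp only [hsub, sum_intUnits, Irrep.dim_triv, Irrep.character_triv, star_div₀, star_sub,
    star_mul', star_natCast, star_one, star_neg, star_ofNat, Nat.cast_one, Units.val_one,
    Units.val_neg, Int.cast_one, Int.cast_neg] at hsum ⊢
  linear_combination hsum - D.gamma_mul_star

theorem dim_sub_character_unipotent_and_card_others :
    (∀ x ∈ D.others, (x.dim : ℂ) - x.character (unipotent 1) = Fintype.card F) ∧
      D.others.card + 1 = Fintype.card F := by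
  choose! m hpos hm using fun x => D.exists_dim_sub_character_unipotent (x := x)
  have hsum := D.sum_others_dim_sub_character_unipotent_mul_star
  rw [Finset.sum_congr rfl fun x hx => by
    rw [hm x hx, star_mul', star_natCast, star_natCast, mul_mul_mul_comm, ← pow_two],
    ← Finset.mul_sum] at hsum
  have hsum' : ∑ x ∈ D.others, m x * m x + 1 = Fintype.card F := by
    have := mul_left_cancel₀ (pow_ne_zero 2 card_cast_ne_zero) hsum
    exact_mod_cast eq_sub_iff_add_eq.1 this
  have hcard := D.card_le_card_others_add_one
  have hone {x : Irrep (SL2 F)} (hx : x ∈ D.others) : m x = 1 :=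
    eq_one_of_sum_mul_self_le_card hpos (by omega) hx
  refine ⟨fun x hx => by rw [hm x hx, hone hx, Nat.cast_one, mul_one], ?_⟩
  rwa [Finset.sum_congr rfl fun x hx => by rw [hone hx, mul_one],
    ← Finset.card_eq_sum_ones] at hsum'

theorem card_others : D.others.card + 1 = Fintype.card F :=
  D.dim_sub_character_unipotent_and_card_others.2

theorem character_unipotent {x : Irrep (SL2 F)} (hx : x ∈ D.others) {b : F} (hb : b ≠ 0) :
    x.character (unipotent b) = x.fixedDim - 1 := by
  have h := D.sum_addChar_mul_character_unipotent hx 1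
  simp only [AddChar.one_apply, one_mul, x.sum_character_unipotent,
    D.dim_sub_character_unipotent_and_card_others.1 x hx, Finset.sum_const, Finset.card_univ,
    nsmul_eq_mul, mul_one] at h
  rw [D.character_unipotent_eq hx hb]
  exact mul_left_cancel₀ card_cast_ne_zero (by linear_combination -h)

theorem character_of_trace_eq_two {x : Irrep (SL2 F)} (hx : x ∈ D.others) {g : SL2 F}
    (ht : g.1.trace = 2) (hg : g ≠ 1) : x.character g = x.fixedDim - 1 := by
  obtain ⟨b, hb, hc⟩ := exists_isConj_unipotent ht hg
  rw [x.character_eq_of_isConj hc, D.character_unipotent hx hb]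

theorem dim_eq {x : Irrep (SL2 F)} (hx : x ∈ D.others) :
    (x.dim : ℂ) = x.fixedDim + (Fintype.card F - 1) := by
  linear_combination D.dim_sub_character_unipotent_and_card_others.1 x hx +
    D.character_unipotent hx one_ne_zero

theorem card_others_cast : (D.others.card : ℂ) = Fintype.card F - 1 := by
  rw [← D.card_others, Nat.cast_add, Nat.cast_one, add_sub_cancel_right]

theorem sum_others_fixedDim : ∑ x ∈ D.others, (x.fixedDim : ℂ) = Fintype.card F - 2 := by
  have hsum : ∑ x : Irrep (SL2 F), (x.dim : ℂ) * (x.dim - x.character (unipotent 1)) =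
      Fintype.card F * ((Fintype.card F : ℂ) ^ 2 - 1) := by
    simp only [mul_sub, Finset.sum_sub_distrib, sum_dim_sq, card_SL2_cast, mul_one,
      sum_dim_mul_character_of_ne_one (unipotent_ne_one (one_ne_zero (α := F))), sub_zero]
  have hothers : ∑ x ∈ D.others, (x.dim : ℂ) * (x.dim - x.character (unipotent 1)) =
      (∑ x ∈ D.others, (x.fixedDim : ℂ) + (Fintype.card F - 1) * (Fintype.card F - 1)) *
        Fintype.card F := by
    rw [Finset.sum_congr rfl fun x hx => by
      rw [D.dim_sub_character_unipotent_and_card_others.1 x hx, D.dim_eq hx], ← Finset.sum_mul,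
      Finset.sum_add_distrib, Finset.sum_const, nsmul_eq_mul, D.card_others_cast]
  rw [D.sum_eq, hothers] at hsum
  simp only [sum_intUnits, Irrep.dim_triv, Irrep.character_triv, D.dim_irrep,
    D.character_unipotent_one, Nat.cast_one, Units.val_one, Units.val_neg, Int.cast_one,
    Int.cast_neg] at hsum
  exact mul_left_cancel₀ card_cast_ne_zero (by linear_combination hsum)

theorem sum_others_fixedDim_mul_sub_two :
    ∑ x ∈ D.others, (x.fixedDim : ℤ) * (x.fixedDim - 2) = -1 := by
  have hsum := sum_dim_mul_character_of_ne_one (unipotent_ne_one (one_ne_zero (α := F)))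
  have hothers : ∑ x ∈ D.others, (x.dim : ℂ) * x.character (unipotent 1) =
      ∑ x ∈ D.others, (x.fixedDim : ℂ) * (x.fixedDim - 2) +
        (Fintype.card F * (Fintype.card F - 2) - (Fintype.card F - 1) * (Fintype.card F - 1)) := by
    rw [← D.sum_others_fixedDim, Finset.mul_sum, ← D.card_others_cast, ← nsmul_eq_mul,
      ← Finset.sum_const, ← Finset.sum_sub_distrib, ← Finset.sum_add_distrib, D.card_others_cast]
    refine Finset.sum_congr rfl fun x hx => ?_
    rw [D.character_unipotent hx one_ne_zero, D.dim_eq hx]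
    ring
  rw [D.sum_eq, hothers] at hsum
  simp only [sum_intUnits, Irrep.dim_triv, Irrep.character_triv, D.dim_irrep,
    D.character_unipotent_one, Nat.cast_one, Units.val_one, Units.val_neg, Int.cast_one,
    Int.cast_neg] at hsum
  rw [← Int.cast_inj (α := ℂ)]
  push_cast
  linear_combination hsum

theorem exists_fixedDim_eq_one : ∃ x ∈ D.others, x.fixedDim = 1 := by
  by_contra! h
  have hnonneg : 0 ≤ ∑ x ∈ D.others, (x.fixedDim : ℤ) * (x.fixedDim - 2) :=
    Finset.sum_nonneg fun x hx => by
      rcases Nat.eq_zero_or_pos x.fixedDim with h0 | h0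
      · rw [h0, Nat.cast_zero, zero_mul]
      · have := h x hx
        exact mul_nonneg (by omega) (by omega)
  rw [D.sum_others_fixedDim_mul_sub_two] at hnonneg
  omega

theorem fixedDim_eq_zero_or_two {s x : Irrep (SL2 F)} (hs : s ∈ D.others) (hs1 : s.fixedDim = 1)
    (huniq : ∀ y ∈ D.others, y.fixedDim = 1 → y = s) (hx : x ∈ D.others) (hxs : x ≠ s) :
    x.fixedDim = 0 ∨ x.fixedDim = 2 := by
  classical
  have hsum := D.sum_others_fixedDim_mul_sub_two
  rw [← Finset.add_sum_erase _ _ hs, hs1] at hsum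
  have hnonneg : ∀ y ∈ D.others.erase s, 0 ≤ (y.fixedDim : ℤ) * (y.fixedDim - 2) :=
    fun y hy => by
      have hne : y.fixedDim ≠ 1 := fun h =>
        (Finset.ne_of_mem_erase hy) (huniq y (Finset.mem_of_mem_erase hy) h)
      rcases Nat.eq_zero_or_pos y.fixedDim with h0 | h0
      · rw [h0, Nat.cast_zero, zero_mul]
      · exact mul_nonneg (by omega) (by omega)
  have hzero := (Finset.sum_eq_zero_iff_of_nonneg hnonneg).1 (by push_cast at hsum; linarith) x
    (Finset.mem_erase.2 ⟨hxs, hx⟩)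
  rcases mul_eq_zero.1 hzero with h | h <;> omega

end WeilIrreps

end Counting

section Steinberg

theorem SL2.induction_on_trace {F : Type*} [Field F] (h2 : (2 : F) ≠ 0) {p : SL2 F → Prop}
    (neg : ∀ g, p (-g) → p g) (one : p 1) (trace_eq_two : ∀ g, g.1.trace = 2 → g ≠ 1 → p g)
    (split : ∀ g a, a ≠ a⁻¹ → IsConj g (upper a 0) → p g) (elliptic : ∀ g, IsElliptic g → p g)
    (g : SL2 F) : p g := by
  have htwo (g : SL2 F) (ht : g.1.trace = 2) : p g := by
    rcases eq_or_ne g 1 with rfl | hg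
    exacts [one, trace_eq_two g ht hg]
  rcases SL2.trace_cases h2 g with ht | ht | ⟨a, ha, hc⟩ | hg
  exacts [htwo g ht, neg g (htwo _ ht), split g a ha hc, elliptic g hg]

variable {F : Type*} [Field F] [Fintype F]

open scoped Classical in
/-- The character of the Steinberg representation. -/
def steinbergChar (g : SL2 F) : ℂ :=
  if g = 1 ∨ g = -1 then Fintype.card F else chi ((g.1.trace - 2) * (g.1.trace + 2))

theorem steinbergChar_neg (g : SL2 F) : steinbergChar (-g) = steinbergChar g := by
  have hg : -g = 1 ∨ -g = -1 ↔ g = 1 ∨ g = -1 := by rw [neg_inj, neg_eq_iff_eq_neg, or_comm]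
  rw [steinbergChar, steinbergChar, trace_neg]
  by_cases h : g = 1 ∨ g = -1
  · rw [if_pos h, if_pos (hg.2 h)]
  · rw [if_neg h, if_neg (mt hg.1 h)]
    ring_nf

theorem steinbergChar_of_ne {g : SL2 F} (h1 : g ≠ 1) (h1' : g ≠ -1) :
    steinbergChar g = chi (g.1.trace - 2) * chi (g.1.trace + 2) := by
  rw [steinbergChar, if_neg (not_or.2 ⟨h1, h1'⟩), map_mul]

theorem steinbergChar_one : steinbergChar (1 : SL2 F) = Fintype.card F := if_pos (Or.inl rfl)

theorem steinbergChar_of_trace_eq_two (h2 : (2 : F) ≠ 0) {g : SL2 F} (ht : g.1.trace = 2)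
    (hg : g ≠ 1) : steinbergChar g = 0 := by
  rw [steinbergChar_of_ne hg (ne_neg_one_of_trace_eq_two h2 ht), ht, sub_self, chi_zero, zero_mul]

theorem steinbergChar_of_isConj_upper {g : SL2 F} {a : Fˣ} (ha : a ≠ a⁻¹)
    (hc : IsConj g (upper a 0)) : steinbergChar g = 1 := by
  have hg : IsSplit g := ⟨a, ha, hc⟩
  rw [steinbergChar_of_ne hg.ne_one hg.ne_neg_one,
    chi_trace_sub_two_of_isConj_upper ha hc, chi_trace_add_two_of_isConj_upper ha hc,
    chi_mul_self a.ne_zero]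

theorem IsElliptic.steinbergChar {g : SL2 F} (hg : IsElliptic g) : steinbergChar g = -1 := by
  rw [steinbergChar_of_ne hg.ne_one hg.ne_neg_one, hg.chi_trace_add_two,
    mul_neg, chi_mul_self (sub_ne_zero.2 hg.trace_ne_two)]

theorem star_weilSum (σ : ℤˣ) (g : SL2 F) : star (weilSum σ g) = weilSum σ g := by
  have hpair (g : SL2 F) : star (weilPairCharacter g) = weilPairCharacter g := by
    rw [weilPairCharacter]
    split_ifs
    · rw [star_mul', star_ofNat, star_natCast]
    · rw [star_mul', star_ofNat, star_chi]
  simp only [weilSum, parityPart, star_div₀, star_add, star_mul', hpair, star_chi, star_ofNat,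
    star_intCast]

theorem sum_character_of_ne_triv {G : Type*} [Group G] [Fintype G] {x : Irrep G}
    (hx : x ≠ Irrep.triv G) : ∑ g, x.character g = 0 := by
  classical
  have h := x.sum_character_mul_star (Irrep.triv G)
  simpa only [if_neg hx, Irrep.character_triv, star_one, mul_one] using h

open scoped ComplexOrder

namespace WeilIrreps

variable {ε : F} (D : WeilIrreps ε)

include D in
theorem sum_weilSum_mul_star (σ : ℤˣ) :
    ∑ g : SL2 F, weilSum σ g * star (weilSum σ g) = 2 * Fintype.card (SL2 F) := by
  classical
  have hne : D.irrep σ 1 ≠ D.irrep σ (-1) := fun h =>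
    absurd (D.irrep_injective (a₁ := (σ, 1)) (a₂ := (σ, -1)) h) (by simp)
  simp only [← D.sum_character, sum_intUnits, star_add, mul_add, add_mul, Finset.sum_add_distrib,
    Irrep.sum_character_mul_star, if_true, if_neg hne, if_neg hne.symm]
  ring

section

variable {x : Irrep (SL2 F)} (hx : x ∈ D.others)

include hx

theorem sum_character_mul_star_weilSum (σ : ℤˣ) :
    ∑ g, x.character g * star (weilSum σ g) = 0 := by
  classical
  have hne (τ : ℤˣ) : x ≠ D.irrep σ τ := fun h =>
    (D.mem_others.1 hx).2 (D.mem_gens.2 ⟨σ, τ, h.symm⟩)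
  simp only [← D.sum_character, sum_intUnits, star_add, mul_add, Finset.sum_add_distrib,
    Irrep.sum_character_mul_star, if_neg (hne _), add_zero]

variable (h1 : x.fixedDim = 1)

include h1

theorem character_one_of_fixedDim_eq_one : x.character 1 = Fintype.card F := by
  rw [x.character_one, D.dim_eq hx, h1]
  ring

theorem character_of_trace_eq_two_of_fixedDim_eq_one {g : SL2 F} (ht : g.1.trace = 2)
    (hg : g ≠ 1) : x.character g = 0 := by
  rw [D.character_of_trace_eq_two hx ht hg, h1, Nat.cast_one, sub_self]

-- If `α = chi`, then `x.character * weilSum 1` is nonnegative, although `x` is orthogonal to the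
-- even constituents.
theorem torus_character_ne_chi {α : Fˣ →* ℂ}
    (hα : ∀ a, ∑ b, x.character (upper a b) = Fintype.card F * α a) : ¬ ∀ a, α a = chi (a : F) := by
  intro hchi
  have hsign : (x.centralSign : ℂ) = chi (-1 : F) := by
    rw [← Irrep.torus_character_neg_one hα, hchi, Units.val_neg, Units.val_one]
  have hone : x.character 1 * star (weilSum 1 (1 : SL2 F)) =
      Fintype.card F * (Fintype.card F + 1) := by
    rw [star_weilSum, weilSum_one 1 D.two_ne_zero, D.character_one_of_fixedDim_eq_one hx h1,
      Units.val_one, Int.cast_one]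
  have hnonneg : ∀ g, 0 ≤ x.character g * star (weilSum 1 g) := by
    refine SL2.induction_on_trace D.two_ne_zero (fun g hg => ?_) ?_ (fun g ht hg => ?_)
      (fun g a ha hc => ?_) fun g hg => ?_
    · rw [x.character_neg, weilSum_neg, hsign, star_mul', star_mul', star_chi] at hg
      convert hg using 1
      rw [Units.val_one, Int.cast_one, star_one]
      linear_combination -(x.character g * star (weilSum 1 g)) * chi_neg_one_mul_self (F := F)
    · rw [hone]
      exact_mod_cast Nat.zero_le (Fintype.card F * (Fintype.card F + 1))
    · rw [D.character_of_trace_eq_two_of_fixedDim_eq_one hx h1 ht hg, zero_mul]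
    · rw [x.character_eq_of_isConj hc, Irrep.character_upper hα ha, hchi, star_weilSum,
        weilSum_of_isConj_upper 1 ha hc, Units.val_one, Int.cast_one, mul_left_comm,
        chi_mul_self a.ne_zero]
      norm_num
    · rw [hg.weilSum, Units.val_one, Int.cast_one, sub_self, zero_mul, star_zero, mul_zero]
  have hzero := (Finset.sum_eq_zero_iff_of_nonneg fun g _ => hnonneg g).1
    (D.sum_character_mul_star_weilSum hx 1) 1 (Finset.mem_univ _)
  rw [hone] at hzero
  exact mul_ne_zero card_cast_ne_zero (Nat.cast_add_one_ne_zero _) hzero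

theorem character_neg_and_character_of_isConj_upper :
    (∀ g, x.character (-g) = x.character g) ∧
      ∀ (g : SL2 F) (a : Fˣ), a ≠ a⁻¹ → IsConj g (upper a 0) → x.character g = 1 := by
  obtain ⟨α, hα⟩ := Irrep.exists_torus_character (x := x)
    (by rw [x.sum_character_unipotent, h1, Nat.cast_one, mul_one])
  have hone := (torus_character_cases α (Irrep.torus_character_mul_self hα)).resolve_right
    (D.torus_character_ne_chi hx h1 hα)
  refine ⟨fun g => ?_, fun g a ha hc => ?_⟩
  · rw [x.character_neg, ← Irrep.torus_character_neg_one hα, hone, one_mul]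
  · rw [x.character_eq_of_isConj hc, Irrep.character_upper hα ha, hone]

-- The nonnegative terms `|x.character g + 1|² - |weilSum 1 g|²` sum to zero, and `weilSum 1`
-- vanishes on elliptic elements.
theorem character_of_isElliptic {g : SL2 F} (hg : IsElliptic g) : x.character g = -1 := by
  obtain ⟨hneg, hsplit⟩ := D.character_neg_and_character_of_isConj_upper hx h1
  have hsum : ∑ g : SL2 F, ((x.character g + 1) * star (x.character g + 1) -
      weilSum 1 g * star (weilSum 1 g)) = 0 := by
    classical
    have hx0 := sum_character_of_ne_triv (D.mem_others.1 hx).1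
    have hx0' := congrArg star hx0
    rw [star_sum, star_zero] at hx0'
    rw [Finset.sum_sub_distrib, D.sum_weilSum_mul_star]
    simp only [star_add, star_one, mul_add, add_mul, Finset.sum_add_distrib, mul_one, one_mul,
      Irrep.sum_character_mul_star, if_true, hx0, hx0', Finset.sum_const, Finset.card_univ,
      nsmul_eq_mul]
    ring
  have hnonneg : ∀ g : SL2 F, 0 ≤ (x.character g + 1) * star (x.character g + 1) -
      weilSum 1 g * star (weilSum 1 g) := by
    refine SL2.induction_on_trace D.two_ne_zero (fun g hg => ?_) ?_ (fun g ht hg => ?_)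
      (fun g a ha hc => ?_) fun g hg => ?_
    · rw [hneg, star_weilSum, weilSum_neg] at hg
      convert hg using 2
      rw [star_weilSum, Units.val_one, Int.cast_one]
      linear_combination -(weilSum 1 g * weilSum 1 g) * chi_neg_one_mul_self (F := F)
    · simp [D.character_one_of_fixedDim_eq_one hx h1, weilSum_one 1 D.two_ne_zero]
    · simp [D.character_of_trace_eq_two_of_fixedDim_eq_one hx h1 ht hg,
        weilSum_of_trace_eq_two 1 D.two_ne_zero ht hg]
    · rw [hsplit g a ha hc, star_weilSum, weilSum_of_isConj_upper 1 ha hc, mul_mul_mul_comm,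
        chi_mul_self a.ne_zero]
      norm_num
    · rw [hg.weilSum, Units.val_one, Int.cast_one, sub_self, zero_mul, zero_mul, sub_zero]
      exact mul_star_self_nonneg _
  have hzero := (Finset.sum_eq_zero_iff_of_nonneg fun g _ => hnonneg g).1 hsum g
    (Finset.mem_univ _)
  rw [hg.weilSum, Units.val_one, Int.cast_one, sub_self, zero_mul, zero_mul, sub_zero,
    CStarRing.mul_star_self_eq_zero_iff] at hzero
  exact eq_neg_of_add_eq_zero_left hzero

theorem character_eq_steinbergChar : x.character = steinbergChar := by
  obtain ⟨hneg, hsplit⟩ := D.character_neg_and_character_of_isConj_upper hx h1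
  refine funext (SL2.induction_on_trace D.two_ne_zero (fun g hg => ?_) ?_ (fun g ht hg => ?_)
    (fun g a ha hc => ?_) fun g hg => ?_)
  · rwa [hneg, steinbergChar_neg] at hg
  · rw [D.character_one_of_fixedDim_eq_one hx h1, steinbergChar_one]
  · rw [D.character_of_trace_eq_two_of_fixedDim_eq_one hx h1 ht hg,
      steinbergChar_of_trace_eq_two D.two_ne_zero ht hg]
  · rw [hsplit g a ha hc, steinbergChar_of_isConj_upper ha hc]
  · rw [D.character_of_isElliptic hx h1 hg, hg.steinbergChar]

end

theorem exists_steinberg : ∃ s ∈ D.others, s.fixedDim = 1 ∧ s.character = steinbergChar ∧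
    ∀ x ∈ D.others, x ≠ s → x.fixedDim = 0 ∨ x.fixedDim = 2 := by
  obtain ⟨s, hs, hs1⟩ := D.exists_fixedDim_eq_one
  refine ⟨s, hs, hs1, D.character_eq_steinbergChar hs hs1, fun x hx hxs =>
    D.fixedDim_eq_zero_or_two hs hs1 (fun y hy hy1 => Irrep.character_injective ?_) hx hxs⟩
  rw [D.character_eq_steinbergChar hs hs1, D.character_eq_steinbergChar hy hy1]

end WeilIrreps

end Steinberg

section Filtration

section Appears

variable {F : Type*} [Field F]

theorem AppearsIn.nonempty_iso {U V : FDRep ℂ (SL2 F)} [Simple U] [Simple V]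
    (h : AppearsIn U V) : Nonempty (U ≅ V) := by
  obtain ⟨f, hf⟩ := h
  have hf0 : f ≠ 0 := by
    rintro rfl
    exact Simple.not_isZero U (Limits.IsZero.of_mono_zero U V)
  have := isIso_of_mono_of_nonzero hf0
  exact ⟨asIso f⟩

theorem AppearsIn.refl (V : FDRep ℂ (SL2 F)) : AppearsIn V V := ⟨𝟙 V, inferInstance⟩

theorem AppearsIn.congr {U V U' V' : FDRep ℂ (SL2 F)} (h : AppearsIn U V) (e : U' ≅ U)
    (e' : V ≅ V') : AppearsIn U' V' := by
  obtain ⟨f, hf⟩ := h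
  exact ⟨e.hom ≫ f ≫ e'.hom, inferInstance⟩

theorem character_tensorList_pair (V W : FDRep ℂ (SL2 F)) (g : SL2 F) :
    (tensorList [V, W]).character g = V.character g * W.character g := by
  change (V ⊗ (W ⊗ 𝟙_ (FDRep ℂ (SL2 F)))).character g = _
  rw [FDRep.char_iso (whiskerLeftIso V (ρ_ W)), FDRep.char_tensor, Pi.mul_apply]

end Appears

variable {F : Type*} [Field F] [Fintype F]

theorem appearsIn_of_sum_ne_zero {U V : FDRep ℂ (SL2 F)} [Simple U]
    (h : ∑ g, V.character g * star (U.character g) ≠ 0) : AppearsIn U V := by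
  rw [sum_character_mul_star_eq_finrank, mul_ne_zero_iff, Nat.cast_ne_zero, Nat.cast_ne_zero] at h
  have := Module.nontrivial_of_finrank_pos (Nat.pos_of_ne_zero h.2)
  obtain ⟨f, hf⟩ := exists_ne (0 : U ⟶ V)
  exact ⟨f, mono_of_nonzero_from_simple hf⟩

theorem memFiltration_iff {k : ℕ} {V : FDRep ℂ (SL2 F)} [Simple V] : MemFiltration k V ↔
    ∃ l : List (FDRep ℂ (SL2 F)), l.length ≤ k ∧ (∀ W ∈ l, IsGenerator F W) ∧
      AppearsIn V (tensorList l) := by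
  refine ⟨fun h => h V inferInstance (AppearsIn.refl V), ?_⟩
  rintro ⟨l, hl, hg, ha⟩ U hU hUV
  obtain ⟨e⟩ := hUV.nonempty_iso
  exact ⟨l, hl, hg, ha.congr e (Iso.refl _)⟩

theorem MemFiltration.mono {j k : ℕ} (hjk : j ≤ k) {V : FDRep ℂ (SL2 F)}
    (h : MemFiltration j V) : MemFiltration k V := fun U hU hUV =>
  let ⟨l, hl, hg, ha⟩ := h U hU hUV
  ⟨l, hl.trans hjk, hg, ha⟩

theorem MemFiltration.congr {k : ℕ} {V W : FDRep ℂ (SL2 F)} (h : MemFiltration k V)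
    (e : V ≅ W) : MemFiltration k W := fun U hU hUW => h U hU (hUW.congr (Iso.refl U) e.symm)

theorem hasTensorRank_succ_iff {k : ℕ} {V : FDRep ℂ (SL2 F)} :
    HasTensorRank (k + 1) V ↔ MemFiltration (k + 1) V ∧ ¬ MemFiltration k V :=
  ⟨fun h => ⟨h.1, h.2 k k.lt_succ_self⟩, fun h =>
    ⟨h.1, fun _ hj hm => h.2 (hm.mono (Nat.le_of_lt_succ hj))⟩⟩

theorem mk_mem_irrepsOfRank {k : ℕ} {V : SimpleRep (SL2 F)} :
    ⟦V⟧ ∈ irrepsOfRank F k ↔ HasTensorRank k V.1 := by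
  refine ⟨?_, fun h => ⟨V, rfl, h⟩⟩
  rintro ⟨W, hW, h⟩
  obtain ⟨e⟩ := Quotient.exact hW
  exact ⟨h.1.congr e, fun j hj hm => h.2 j hj (hm.congr e.symm)⟩

theorem memFiltration_zero_iff {V : SimpleRep (SL2 F)} :
    MemFiltration 0 V.1 ↔ (⟦V⟧ : Irrep (SL2 F)) = Irrep.triv (SL2 F) := by
  have := V.2
  have := simple_unit (G := SL2 F)
  rw [memFiltration_iff]
  constructor
  · rintro ⟨l, hl, -, ha⟩
    obtain rfl := List.length_eq_zero_iff.1 (Nat.le_zero.1 hl)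
    exact Quotient.sound (AppearsIn.nonempty_iso (V := 𝟙_ (FDRep ℂ (SL2 F))) ha)
  · intro h
    obtain ⟨e⟩ := Quotient.exact h
    exact ⟨[], le_rfl, by simp, (AppearsIn.refl (𝟙_ (FDRep ℂ (SL2 F)))).congr e (Iso.refl _)⟩

theorem memFiltration_one_iff {V : SimpleRep (SL2 F)} : MemFiltration 1 V.1 ↔
    (⟦V⟧ : Irrep (SL2 F)) = Irrep.triv (SL2 F) ∨ IsGenerator F V.1 := by
  have := V.2
  rw [← memFiltration_zero_iff]
  constructor
  · intro h
    obtain ⟨l, hl, hg, ha⟩ := memFiltration_iff.1 h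
    match l, hl with
    | [], _ => exact Or.inl (memFiltration_iff.2 ⟨[], le_rfl, hg, ha⟩)
    | [W], _ =>
      have hW := hg W (List.mem_singleton_self W)
      have := hW.1
      obtain ⟨e⟩ := (ha.congr (Iso.refl _) (ρ_ W)).nonempty_iso
      refine Or.inr ⟨V.2, ?_⟩
      rw [(FDRep.isoToLinearEquiv e).finrank_eq]
      exact hW.2
  · rintro (h | h)
    · exact h.mono zero_le_one
    · exact memFiltration_iff.2 ⟨[V.1], le_rfl, by simpa using h,
        (AppearsIn.refl _).congr (Iso.refl _) (ρ_ V.1).symm⟩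

end Filtration

section Rank

variable {F : Type*} [Field F] [Fintype F] {ε : F}

theorem sum_weilSum (g : SL2 F) : ∑ σ, weilSum σ g = weilPairCharacter g := by
  rw [sum_intUnits, weilSum, weilSum, parityPart, parityPart]
  push_cast
  ring

open scoped Classical in
theorem weilPairCharacter_mul_self (g : SL2 F) : weilPairCharacter g * weilPairCharacter g =
    4 - (if g.1.trace = 2 then 4 else 0) +
      if g = 1 then 4 * (Fintype.card F : ℂ) ^ 2 else 0 := by
  by_cases h1 : g = 1
  · rw [weilPairCharacter, if_pos h1, if_pos h1, h1, if_pos trace_one]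
    ring
  · by_cases ht : g.1.trace = 2
    · rw [weilPairCharacter_of_ne_one h1, if_neg h1, if_pos ht, ht, sub_self, chi_zero]
      ring
    · rw [weilPairCharacter_of_ne_one h1, if_neg ht, if_neg h1]
      linear_combination 4 * chi_mul_self (sub_ne_zero.2 ht)

namespace WeilIrreps

variable (D : WeilIrreps ε)

theorem sum_gens_character (g : SL2 F) : ∑ x ∈ D.gens, x.character g = weilPairCharacter g := by
  simp only [D.sum_gens, D.sum_character, sum_weilSum]

theorem two_mul_dim_irrep (σ τ : ℤˣ) : (2 * (D.irrep σ τ).dim : ℤ) = Fintype.card F + σ := by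
  have h : ((2 * (D.irrep σ τ).dim : ℤ) : ℂ) = (Fintype.card F + σ : ℤ) := by
    push_cast
    rw [D.dim_irrep]
    ring
  exact_mod_cast h

theorem mem_gens_iff_dim (hq : 3 < Fintype.card F) {x : Irrep (SL2 F)} :
    x ∈ D.gens ↔ 2 * x.dim = Fintype.card F + 1 ∨ 2 * x.dim + 1 = Fintype.card F := by
  constructor
  · rw [D.mem_gens]
    rintro ⟨σ, τ, rfl⟩
    have hdim := D.two_mul_dim_irrep σ τ
    rcases Int.units_eq_one_or σ with rfl | rfl <;> push_cast at hdim <;> omega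
  · intro h
    by_contra hx
    have htriv : x ≠ Irrep.triv (SL2 F) := by
      rintro rfl
      rw [Irrep.dim_triv] at h
      omega
    have hdim : x.dim + 1 = x.fixedDim + Fintype.card F := by
      have h := D.dim_eq (D.mem_others.2 ⟨htriv, hx⟩)
      exact_mod_cast (by linear_combination h :
        (x.dim : ℂ) + 1 = x.fixedDim + Fintype.card F)
    omega

theorem mk_mem_gens_iff (hq : 3 < Fintype.card F) {V : SimpleRep (SL2 F)} :
    ⟦V⟧ ∈ D.gens ↔ IsGenerator F V.1 :=
  (D.mem_gens_iff_dim hq).trans (and_iff_right V.2).symm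

theorem irrepsOfRank_one (hq : 3 < Fintype.card F) : irrepsOfRank F 1 = D.gens := by
  ext x
  induction x using Quotient.inductionOn with | _ V =>
  rw [mk_mem_irrepsOfRank, hasTensorRank_succ_iff, memFiltration_one_iff, memFiltration_zero_iff,
    ← D.mk_mem_gens_iff hq, Finset.mem_coe]
  exact ⟨fun h => h.1.resolve_left h.2,
    fun h => ⟨Or.inr h, fun htriv => D.triv_notMem_gens (htriv ▸ h)⟩⟩

open scoped Classical in
theorem sum_trace_eq_two_star_character {x : Irrep (SL2 F)} (hx : x ∈ D.others) :
    ∑ g : SL2 F with g.1.trace = 2, star (x.character g) =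
      x.dim + ((Fintype.card F : ℂ) ^ 2 - 1) * (x.fixedDim - 1) := by
  have hone : (1 : SL2 F) ∈ Finset.univ.filter fun g : SL2 F => g.1.trace = 2 :=
    Finset.mem_filter.2 ⟨Finset.mem_univ _, trace_one⟩
  have hunipotent : ∀ g ∈ (Finset.univ.filter fun g : SL2 F => g.1.trace = 2).erase 1,
      star (x.character g) = x.fixedDim - 1 := fun g hg => by
    obtain ⟨hg1, hg⟩ := Finset.mem_erase.1 hg
    rw [D.character_of_trace_eq_two hx (Finset.mem_filter.1 hg).2 hg1, star_sub, star_natCast,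
      star_one]
  rw [← Finset.add_sum_erase _ _ hone, Finset.sum_congr rfl hunipotent, Finset.sum_const,
    nsmul_eq_mul, Finset.card_erase_of_mem hone, card_trace_eq_two, x.character_one, star_natCast,
    Nat.cast_sub (Nat.one_le_pow _ _ Fintype.card_pos)]
  push_cast
  rfl

theorem sum_weilPairCharacter_sq_mul_star {x : Irrep (SL2 F)} (hx : x ∈ D.others) :
    ∑ g, weilPairCharacter g * weilPairCharacter g * star (x.character g) =
      4 * Fintype.card (SL2 F) := by
  classical
  have hsum := congrArg star (sum_character_of_ne_triv (D.mem_others.1 hx).1)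
  rw [star_sum, star_zero] at hsum
  simp only [weilPairCharacter_mul_self, add_mul, sub_mul, Finset.sum_add_distrib,
    Finset.sum_sub_distrib, ite_mul, zero_mul, ← Finset.sum_filter, ← Finset.mul_sum,
    D.sum_trace_eq_two_star_character hx, hsum, Finset.filter_eq', Finset.mem_univ, if_true,
    Finset.sum_singleton, x.character_one, star_natCast, card_SL2_cast]
  rw [D.dim_eq hx]
  ring

theorem memFiltration_two {V : SimpleRep (SL2 F)} (hq : 3 < Fintype.card F)
    (hV : ⟦V⟧ ∈ D.others) : MemFiltration 2 V.1 := by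
  have := V.2
  have h := (D.sum_weilPairCharacter_sq_mul_star hV).trans_ne
    (mul_ne_zero (OfNat.ofNat_ne_zero 4) card_cast_ne_zero)
  simp only [← D.sum_gens_character, Finset.mul_sum, Finset.sum_mul] at h
  rw [Finset.sum_comm] at h
  obtain ⟨y, hy, h⟩ := Finset.exists_ne_zero_of_sum_ne_zero h
  rw [Finset.sum_comm] at h
  obtain ⟨x, hx, h⟩ := Finset.exists_ne_zero_of_sum_ne_zero h
  induction x using Quotient.inductionOn with | _ W =>
  induction y using Quotient.inductionOn with | _ W' =>
  rw [D.mk_mem_gens_iff hq] at hx hy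
  refine memFiltration_iff.2 ⟨[W.1, W'.1], le_rfl, by simp [hx, hy],
    appearsIn_of_sum_ne_zero ?_⟩
  simp only [character_tensorList_pair]
  exact h

theorem irrepsOfRank_two (hq : 3 < Fintype.card F) : irrepsOfRank F 2 = D.others := by
  ext x
  induction x using Quotient.inductionOn with | _ V =>
  rw [mk_mem_irrepsOfRank, hasTensorRank_succ_iff, memFiltration_one_iff,
    ← D.mk_mem_gens_iff hq, not_or, ← D.mem_others, Finset.mem_coe]
  exact and_iff_right_of_imp (D.memFiltration_two hq)

theorem ratioSum_one (hq : 3 < Fintype.card F) (g : SL2 F) :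
    ratioSum 1 g = ∑ x ∈ D.gens, x.character g / x.dim :=
  Finset.sum_congr (by simp [D.irrepsOfRank_one hq]) fun _ _ => rfl

theorem ratioSum_two (hq : 3 < Fintype.card F) (g : SL2 F) :
    ratioSum 2 g = ∑ x ∈ D.others, x.character g / x.dim :=
  Finset.sum_congr (by simp [D.irrepsOfRank_two hq]) fun _ _ => rfl

end WeilIrreps

end Rank

section RatioSums

variable {F : Type*} [Field F] [Fintype F]

open scoped Classical in
theorem sum_character_mul_star_unipotent_add {ε : F} (hε : ¬ IsSquare ε) {g : SL2 F} (h1 : g ≠ 1) :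
    ∑ x : Irrep (SL2 F),
        x.character g * star (x.character (unipotent 1) + x.character (unipotent ε)) =
      if g.1.trace = 2 then 2 * (Fintype.card F : ℂ) else 0 := by
  have h2 := two_ne_zero_of_not_isSquare hε
  have hnc := not_isConj_unipotent hε
  simp only [star_add, mul_add, Finset.sum_add_distrib]
  split_ifs with ht
  · rcases (isConj_unipotent_iff_trace_eq_two hε h1).2 ht with hc | hc
    · simp only [Irrep.character_eq_of_isConj _ hc]
      rw [sum_character_unipotent_mul_star h2 one_ne_zero,
        sum_irrep_character_mul_star_of_not_isConj hnc, add_zero]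
    · simp only [Irrep.character_eq_of_isConj _ hc]
      rw [sum_character_unipotent_mul_star h2 (ne_zero_of_not_isSquare hε),
        sum_irrep_character_mul_star_of_not_isConj fun h => hnc h.symm, zero_add]
  · obtain ⟨hone, hε⟩ := not_or.1 (mt (isConj_unipotent_iff_trace_eq_two hε h1).1 ht)
    rw [sum_irrep_character_mul_star_of_not_isConj hone,
      sum_irrep_character_mul_star_of_not_isConj hε, add_zero]

theorem card_cast_sub_one_ne_zero : (Fintype.card F - 1 : ℂ) ≠ 0 :=
  sub_ne_zero.2 (by exact_mod_cast Fintype.one_lt_card.ne')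

namespace WeilIrreps

variable {ε : F} (D : WeilIrreps ε) {g : SL2 F}

include D in
theorem ratioSum_one_eq (hq : 3 < Fintype.card F) (h1 : g ≠ 1) (h1' : g ≠ -1) :
    ratioSum 1 g = 4 * (Fintype.card F * chi (g.1.trace - 2) - chi (g.1.trace + 2)) /
      ((Fintype.card F : ℂ) ^ 2 - 1) := by
  have hσ (σ : ℤˣ) : ∑ τ, (D.irrep σ τ).character g / (D.irrep σ τ).dim =
      (chi (g.1.trace - 2) + σ * chi (g.1.trace + 2)) / ((Fintype.card F + σ) / 2) := by
    simp only [D.dim_irrep, ← Finset.sum_div, D.sum_character, weilSum_of_ne σ h1 h1']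
  have hsub := card_cast_sub_one_ne_zero (F := F)
  have hadd : (Fintype.card F + 1 : ℂ) ≠ 0 := Nat.cast_add_one_ne_zero _
  rw [D.ratioSum_one hq, D.sum_gens, sum_intUnits, hσ, hσ, Units.val_neg, Units.val_one,
    Int.cast_neg, Int.cast_one, ← sub_eq_add_neg,
    show (Fintype.card F : ℂ) ^ 2 - 1 = (Fintype.card F - 1) * (Fintype.card F + 1) by ring]
  field_simp
  ring

theorem sum_others_dim_mul_character (h1 : g ≠ 1) (h1' : g ≠ -1) :
    ∑ x ∈ D.others, (x.dim : ℂ) * x.character g =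
      -(1 + Fintype.card F * chi (g.1.trace - 2) + chi (g.1.trace + 2)) := by
  have hsum := sum_dim_mul_character_of_ne_one h1
  rw [D.sum_eq] at hsum
  simp only [D.dim_irrep, ← Finset.mul_sum, D.sum_character, weilSum_of_ne _ h1 h1', sum_intUnits,
    Irrep.dim_triv, Irrep.character_triv, Units.val_one, Units.val_neg, Int.cast_one,
    Int.cast_neg, Nat.cast_one] at hsum
  linear_combination hsum

open scoped Classical in
theorem sum_others_fixedDim_sub_one_mul_character (h1 : g ≠ 1) (h1' : g ≠ -1) :
    ∑ x ∈ D.others, (x.fixedDim - 1 : ℂ) * x.character g =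
      (if g.1.trace = 2 then (Fintype.card F : ℂ) else 0) - 1 - chi (g.1.trace + 2) := by
  have hsum := sum_character_mul_star_unipotent_add D.not_isSquare h1
  have hirrep (σ τ : ℤˣ) : (D.irrep σ τ).character (unipotent 1) +
      (D.irrep σ τ).character (unipotent ε) = σ := by
    rw [D.character_unipotent_one, D.character_unipotent_nonsquare]
    ring
  have hothers : ∀ x ∈ D.others, x.character g *
      star (x.character (unipotent 1) + x.character (unipotent ε)) =
        2 * ((x.fixedDim - 1) * x.character g) := fun x hx => by
    rw [← D.character_unipotent_one_eq hx, D.character_unipotent hx one_ne_zero, ← two_mul,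
      star_mul', star_sub, star_natCast, star_one, star_ofNat]
    ring
  rw [D.sum_eq, Finset.sum_congr rfl hothers, ← Finset.mul_sum] at hsum
  simp only [hirrep, star_intCast, ← Finset.sum_mul, D.sum_character, weilSum_of_ne _ h1 h1',
    sum_intUnits, Irrep.character_triv, Units.val_one, Units.val_neg, Int.cast_one, Int.cast_neg,
    star_add, star_one] at hsum
  split_ifs at hsum ⊢ <;> linear_combination hsum / 2

open scoped Classical in
theorem sum_others_character (h1 : g ≠ 1) (h1' : g ≠ -1) :
    ∑ x ∈ D.others, x.character g =
      -chi (g.1.trace - 2) - if g.1.trace = 2 then 1 else 0 := by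
  have hdim := D.sum_others_dim_mul_character h1 h1'
  have hfixed := D.sum_others_fixedDim_sub_one_mul_character h1 h1'
  have hx : ∀ x ∈ D.others, (x.dim : ℂ) * x.character g =
      (x.fixedDim - 1) * x.character g + Fintype.card F * x.character g := fun x hx => by
    rw [D.dim_eq hx]
    ring
  rw [Finset.sum_congr rfl hx, Finset.sum_add_distrib, hfixed, ← Finset.mul_sum] at hdim
  refine mul_left_cancel₀ (card_cast_ne_zero (α := F)) ?_
  split_ifs at hdim ⊢ <;> linear_combination hdim

-- For `f = x.fixedDim` in `{0, 2}`, `1 / dim` is an affine function of `f`; the Steinberg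
-- representation, with `f = 1`, needs a correction.
theorem character_div_dim {s x : Irrep (SL2 F)} (hs1 : s.fixedDim = 1) (hx : x ∈ D.others)
    (hne : x ≠ s → x.fixedDim = 0 ∨ x.fixedDim = 2) [Decidable (x = s)] :
    x.character g / x.dim =
      (Fintype.card F * x.character g - (x.fixedDim - 1) * x.character g -
        if x = s then s.character g / Fintype.card F else 0) /
        ((Fintype.card F : ℂ) ^ 2 - 1) := by
  have hq := card_cast_ne_zero (α := F)
  have hsub := card_cast_sub_one_ne_zero (F := F)
  have hadd : (Fintype.card F + 1 : ℂ) ≠ 0 := Nat.cast_add_one_ne_zero _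
  rw [D.dim_eq hx,
    show (Fintype.card F : ℂ) ^ 2 - 1 = (Fintype.card F - 1) * (Fintype.card F + 1) by ring]
  split_ifs with h
  · rw [h, hs1, Nat.cast_one, add_sub_cancel]
    field_simp
    ring
  · rcases hne h with h | h <;> rw [h] <;> push_cast
    · rw [zero_add]
      field_simp
      ring
    · rw [show (2 : ℂ) + (Fintype.card F - 1) = Fintype.card F + 1 by ring]
      field_simp
      ring

open scoped Classical in
include D in
theorem ratioSum_two_eq (hq : 3 < Fintype.card F) (h1 : g ≠ 1) (h1' : g ≠ -1) :
    ratioSum 2 g = (1 + chi (g.1.trace + 2) - Fintype.card F * chi (g.1.trace - 2) -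
      chi (g.1.trace - 2) * chi (g.1.trace + 2) / Fintype.card F -
      if g.1.trace = 2 then 2 * (Fintype.card F : ℂ) else 0) /
        ((Fintype.card F : ℂ) ^ 2 - 1) := by
  obtain ⟨s, hs, hs1, hchar, hne⟩ := D.exists_steinberg
  rw [D.ratioSum_two hq, Finset.sum_congr rfl fun x hx => D.character_div_dim hs1 hx (hne x hx),
    ← Finset.sum_div, Finset.sum_sub_distrib, Finset.sum_sub_distrib, ← Finset.mul_sum,
    D.sum_others_character h1 h1', D.sum_others_fixedDim_sub_one_mul_character h1 h1',
    Finset.sum_ite_eq' D.others s, if_pos hs, hchar, steinbergChar_of_ne h1 h1']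
  split_ifs <;> ring

end WeilIrreps

end RatioSums

section Bounds

variable {F : Type*} [Field F] [Fintype F]

theorem norm_chi {a : F} (ha : a ≠ 0) : ‖chi a‖ = 1 := by
  rcases chi_eq_one_or ha with h | h <;> simp [h]

theorem norm_chi_le_one (a : F) : ‖chi a‖ ≤ 1 := by
  rcases eq_or_ne a 0 with rfl | ha
  · simp [chi_zero]
  · exact (norm_chi ha).le

theorem exists_chi_eq_ofReal (a : F) : ∃ s : ℝ, |s| ≤ 1 ∧ chi a = s := by
  classical
  have h : chi a = ((quadraticChar F a : ℝ) : ℂ) := by rw [chi_apply, Complex.ofReal_intCast]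
  exact ⟨_, by simpa [h] using norm_chi_le_one a, h⟩

theorem sq_sub_one_pos {q : ℝ} (hq : 3 ≤ q) : 0 < q ^ 2 - 1 := by nlinarith

theorem norm_natCast_sq_sub_one {q : ℕ} (hq : 3 ≤ q) : ‖(q : ℂ) ^ 2 - 1‖ = (q : ℝ) ^ 2 - 1 := by
  rw [← Complex.norm_of_nonneg (sq_sub_one_pos (by exact_mod_cast hq)).le]
  push_cast
  rfl

namespace WeilIrreps

variable {ε : F} (D : WeilIrreps ε) {g : SL2 F} (hq : 3 < Fintype.card F)

include D hq

theorem norm_ratioSum_one_of_trace_eq_two (h1 : g ≠ 1) (ht : g.1.trace = 2) :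
    ‖ratioSum 1 g‖ = 4 / ((Fintype.card F : ℝ) ^ 2 - 1) := by
  have h2 := D.two_ne_zero
  rw [D.ratioSum_one_eq hq h1 (ne_neg_one_of_trace_eq_two h2 ht),
    chi_trace_add_two_of_trace_eq_two h2 ht, ht, sub_self, chi_zero, mul_zero, zero_sub, norm_div,
    norm_natCast_sq_sub_one hq.le]
  norm_num

theorem exists_norm_ratioSum_one_eq (h1' : g ≠ -1) (ht : g.1.trace ≠ 2) : ∃ s : ℝ, |s| ≤ 1 ∧
    ‖ratioSum 1 g‖ = 4 * (Fintype.card F - s) / ((Fintype.card F : ℝ) ^ 2 - 1) := by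
  obtain ⟨s, hs, hchi⟩ := exists_chi_eq_ofReal ((g.1.trace - 2) * (g.1.trace + 2))
  refine ⟨s, hs, ?_⟩
  have ht' := sub_ne_zero.2 ht
  have hfactor : 4 * (Fintype.card F * chi (g.1.trace - 2) - chi (g.1.trace + 2)) =
      chi (g.1.trace - 2) * ((4 * (Fintype.card F - s) : ℝ) : ℂ) := by
    push_cast
    rw [← hchi, map_mul]
    linear_combination 4 * chi (g.1.trace + 2) * chi_mul_self ht'
  have hcard : (3 : ℝ) < Fintype.card F := by exact_mod_cast hq
  have hnonneg : 0 ≤ 4 * (Fintype.card F - s) := by linarith [(abs_le.1 hs).2]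
  rw [D.ratioSum_one_eq hq (ne_one_of_trace_ne_two ht) h1', hfactor, norm_div, norm_mul,
    norm_chi ht', one_mul, Complex.norm_of_nonneg hnonneg, norm_natCast_sq_sub_one hq.le]

theorem abs_norm_ratioSum_one_sub_le (h1' : g ≠ -1) (ht : g.1.trace ≠ 2) :
    |‖ratioSum 1 g‖ - 4 / (Fintype.card F + 1)| ≤ 8 / ((Fintype.card F : ℝ) ^ 2 - 1) := by
  obtain ⟨s, hs, hnorm⟩ := D.exists_norm_ratioSum_one_eq hq h1' ht
  have hpos := sq_sub_one_pos (q := Fintype.card F) (by exact_mod_cast hq.le)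
  have hsub : ‖ratioSum 1 g‖ - 4 / (Fintype.card F + 1) =
      4 * (1 - s) / ((Fintype.card F : ℝ) ^ 2 - 1) := by
    rw [hnorm]
    have hadd : (Fintype.card F + 1 : ℝ) ≠ 0 := Nat.cast_add_one_ne_zero _
    have hne := hpos.ne'
    field_simp
    ring
  obtain ⟨hs₁, hs₂⟩ := abs_le.1 hs
  rw [hsub, abs_of_nonneg (div_nonneg (by linarith) hpos.le)]
  gcongr
  linarith

theorem norm_ratioSum_two_of_trace_eq_two (h1 : g ≠ 1) (ht : g.1.trace = 2) :
    ‖ratioSum 2 g‖ = 2 / (Fintype.card F + 1) := by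
  have h2 := D.two_ne_zero
  have hsub := card_cast_sub_one_ne_zero (F := F)
  have hadd : (Fintype.card F + 1 : ℂ) ≠ 0 := Nat.cast_add_one_ne_zero _
  have h : ratioSum 2 g = -((2 / (Fintype.card F + 1) : ℝ) : ℂ) := by
    push_cast
    rw [D.ratioSum_two_eq hq h1 (ne_neg_one_of_trace_eq_two h2 ht),
      chi_trace_add_two_of_trace_eq_two h2 ht, if_pos ht, ht, sub_self, chi_zero,
      show (Fintype.card F : ℂ) ^ 2 - 1 = (Fintype.card F - 1) * (Fintype.card F + 1) by ring]
    field_simp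
    ring
  rw [h, norm_neg, Complex.norm_of_nonneg (by positivity)]

theorem norm_ratioSum_two_le_of_trace_ne_two (h1' : g ≠ -1) (ht : g.1.trace ≠ 2) :
    ‖ratioSum 2 g‖ ≤ (2 * Fintype.card F + 3) / ((Fintype.card F : ℝ) ^ 2 - 1) := by
  have hcard : (3 : ℝ) < Fintype.card F := by exact_mod_cast hq
  have hpos := sq_sub_one_pos hcard.le
  have hchi := norm_chi_le_one (g.1.trace - 2)
  have hchi' := norm_chi_le_one (g.1.trace + 2)
  have hnum : ‖1 + chi (g.1.trace + 2) - Fintype.card F * chi (g.1.trace - 2) -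
      chi (g.1.trace - 2) * chi (g.1.trace + 2) / Fintype.card F‖ ≤
      1 + 1 + Fintype.card F * 1 + 1 * 1 / 1 := by
    refine (norm_sub_le _ _).trans (add_le_add ((norm_sub_le _ _).trans
      (add_le_add ((norm_add_le _ _).trans ?_) ?_)) ?_)
    · rw [norm_one]
      gcongr
    · rw [norm_mul, Complex.norm_natCast]
      gcongr
    · rw [norm_div, norm_mul, Complex.norm_natCast]
      gcongr
      linarith
  rw [D.ratioSum_two_eq hq (ne_one_of_trace_ne_two ht) h1', if_neg ht, sub_zero, norm_div,
    norm_natCast_sq_sub_one hq.le]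
  gcongr
  linarith

theorem norm_ratioSum_two_le (h1 : g ≠ 1) (h1' : g ≠ -1) : ‖ratioSum 2 g‖ ≤
    2 / (Fintype.card F + 1) + 5 / ((Fintype.card F : ℝ) ^ 2 - 1) := by
  have hpos := sq_sub_one_pos (q := Fintype.card F) (by exact_mod_cast hq.le)
  by_cases ht : g.1.trace = 2
  · rw [D.norm_ratioSum_two_of_trace_eq_two hq h1 ht]
    exact le_add_of_nonneg_right (by positivity)
  · refine (D.norm_ratioSum_two_le_of_trace_ne_two hq h1' ht).trans_eq ?_
    have hadd : (Fintype.card F + 1 : ℝ) ≠ 0 := Nat.cast_add_one_ne_zero _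
    have hne := hpos.ne'
    field_simp
    ring

end WeilIrreps

theorem four_div_sq_sub_one_le {q : ℝ} (hq : 3 ≤ q) : 4 / (q ^ 2 - 1) ≤ 8 * (1 / q ^ 2) := by
  rw [mul_one_div, div_le_div_iff₀ (sq_sub_one_pos hq) (by positivity)]
  nlinarith

theorem div_add_div_sq_sub_one_le {a b q : ℝ} (ha : 0 ≤ a) (hb : 0 ≤ b) (hq : 3 ≤ q) :
    a / (q + 1) + b / (q ^ 2 - 1) ≤ (a + b / 2) * (1 / q) :=
  calc a / (q + 1) + b / (q ^ 2 - 1) ≤ a / q + b / (2 * q) := by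
        gcongr
        · linarith
        · nlinarith
    _ = (a + b / 2) * (1 / q) := by
        field_simp

end Bounds

end TensorRank

end

theorem proposition5p2 :
    ∃ C : ℝ, ∀ (F : Type*) [Field F] [Fintype F],
      Odd (Fintype.card F) → 3 < Fintype.card F →
      ∀ (ε : F), ¬ IsSquare ε →
      ∀ (g : TensorRank.SL2 F), g ≠ 1 → g ≠ -1 →
        -- the estimates up to an absolute constant
        ((IsConj g (TensorRank.unipotent 1) ∨ IsConj g (TensorRank.unipotent ε) →
            ‖TensorRank.ratioSum 1 g‖ ≤ C * (1 / (Fintype.card F : ℝ) ^ 2)) ∧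
          (¬ (IsConj g (TensorRank.unipotent 1) ∨ IsConj g (TensorRank.unipotent ε)) →
            ‖TensorRank.ratioSum 1 g‖ ≤ C * (1 / (Fintype.card F : ℝ))) ∧
          ‖TensorRank.ratioSum 2 g‖ ≤ C * (1 / (Fintype.card F : ℝ))) ∧
        -- the explicit bounds
        ((IsConj g (TensorRank.unipotent 1) ∨ IsConj g (TensorRank.unipotent ε) →
            ‖TensorRank.ratioSum 1 g‖ = 4 / ((Fintype.card F : ℝ) ^ 2 - 1)) ∧
          (¬ (IsConj g (TensorRank.unipotent 1) ∨ IsConj g (TensorRank.unipotent ε)) →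
            |‖TensorRank.ratioSum 1 g‖ - 4 / ((Fintype.card F : ℝ) + 1)| ≤
              8 / ((Fintype.card F : ℝ) ^ 2 - 1)) ∧
          ‖TensorRank.ratioSum 2 g‖ ≤
            2 / ((Fintype.card F : ℝ) + 1) + 5 / ((Fintype.card F : ℝ) ^ 2 - 1)) := by
  refine ⟨8, fun F _ _ _ hq ε hε g h1 h1' => ?_⟩
  obtain ⟨D⟩ := TensorRank.nonempty_weilIrreps hε
  rw [TensorRank.isConj_unipotent_iff_trace_eq_two hε h1]
  have hcard : (3 : ℝ) ≤ Fintype.card F := by exact_mod_cast hq.le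
  have hunipotent := D.norm_ratioSum_one_of_trace_eq_two hq h1
  have hother := D.abs_norm_ratioSum_one_sub_le hq h1'
  have htwo := D.norm_ratioSum_two_le hq h1 h1'
  refine ⟨⟨fun ht => ?_, fun ht => ?_, ?_⟩, hunipotent, hother, htwo⟩
  · exact (hunipotent ht).trans_le (TensorRank.four_div_sq_sub_one_le hcard)
  · calc ‖TensorRank.ratioSum 1 g‖
        ≤ 4 / ((Fintype.card F : ℝ) + 1) + 8 / ((Fintype.card F : ℝ) ^ 2 - 1) :=
          sub_le_iff_le_add'.1 ((le_abs_self _).trans (hother ht))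
      _ ≤ (4 + 8 / 2) * (1 / (Fintype.card F : ℝ)) :=
          TensorRank.div_add_div_sq_sub_one_le (by norm_num) (by norm_num) hcard
      _ = 8 * (1 / (Fintype.card F : ℝ)) := by norm_num
  · calc ‖TensorRank.ratioSum 2 g‖
        ≤ (2 + 5 / 2) * (1 / (Fintype.card F : ℝ)) :=
          htwo.trans (TensorRank.div_add_div_sq_sub_one_le (by norm_num) (by norm_num) hcard)
      _ ≤ 8 * (1 / (Fintype.card F : ℝ)) := by gcongr; norm_num
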